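/- **Trees and preclones.** A ranked alphabet $\Sigma=(\Sigma_n)_{n\ge0}$ has finitely many letters, each with a rank. $\Sigma M_k$ is the set of finite ordered trees whose nodes with $m$ children carry letters of $\Sigma_m$, except that exactly $k$ leaves are labeled, from left to right, by the variables $v_1,\dots,v_k$; $\mathbf 1\in\Sigma M_1$ is the tree reduced to $v_1$, and $\mathsf{NV}(t)$ is the set of letter-labeled nodes of $t$. A preclone is a family of sets $(S_n)_{n\ge 0}$ with a unit $\mathbf 1\in S_1$ and a composition sending $f\in S_n$ and $g=g_1\oplus\dots\oplus g_n$ with $g_i\in S_{m_i}$ to $f\cdot g\in S_{\sum_i m_i}$, with the unit and associativity laws satisfied by substitution of trees for variables; $\mathbf k$ is the tuple of $k$ units. A finitary pg-pair $(S,A)$ is a preclone $S$ with all $S_n$ finite, together with a finite set $A$ generating $S$; $A_n=A\cap S_n$. A language $L\subseteq\Sigma M_n$ is recognizable if $L=\varphi^{-1}(P)$ for a preclone morphism $\varphi$ from $\Sigma M$ to a preclone $S$ with all $S_n$ finite and some $P\subseteq S_n$; it is recognized by $(S,A)$ if moreover $\varphi(\Sigma)\subseteq A$. **Block product.** For a preclone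 $T$ let $I_{k,n}$ be the set of contexts $(u,k_1,v,k_2)$ with $u\in T_{k_1+1+k_2}$ and $v=v_1\oplus\dots\oplus v_n$ a tuple of elements of $T$ of total rank $k-k_1-k_2\ge0$. The preclone $S\,\square_k\,T$ has $(S\,\square_k\,T)_n=S_n^{I_{k,n}}\times T_n$, unit $(C\mapsto\mathbf 1,\mathbf 1)$ and composition $(F,f)\cdot\bigoplus_i(G_i,g_i)=(Q,f\cdot g)$, where $g=\bigoplus_i g_i$, $Q(u,k_1,v,k_2)=F(u,k_1,g\cdot v,k_2)\cdot\bigoplus_iG_i(c_i,p_1,\bar v_i,p_2)$, $\bar v_i$ is the block of $v$ attached under $g_i$, $c_i=u\cdot(\mathbf k_1\oplus f\cdot(\cdots\oplus g_{i-1}\cdot\bar v_{i-1}\oplus\mathbf 1\oplus g_{i+1}\cdot\bar v_{i+1}\oplus\cdots)\oplus\mathbf k_2)$, and $p_1=k_1+\sum_{j<i}\mathrm{rank}(\bar v_j)$, $p_2=\sum_{j>i}\mathrm{rank}(\bar v_j)+k_2$. The pg-pair $(S,A)\,\square_k\,(T,B)$ is the sub-preclone of $S\,\square_k\,T$ generated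 by the pairs $(F,b)$ with $b\in B_n$, $F\colon I_{k,n}\to A_n$ $(n\ge0)$, with these pairs as generators. **Logic.** Formulas of rank $k$ over $\Sigma$ are interpreted on trees $t\in\Sigma M_k$, $t\ne\mathbf 1$, with first-order variables ranging over $\mathsf{NV}(t)$. They are built with Boolean connectives and constants from the atoms $P_\sigma(x)$ ($x$ has label $\sigma$), $x<y$ ($y$ is a proper descendant of $x$), $\mathsf{Succ}_i(x,y)$ ($y$ is the $i$-th child of $x$), $\mathsf{root}(x)$, $\mathsf{max}_{i,j}(x)$ (the $i$-th child of $x$ is the leaf $v_j$), $\mathsf{left}_j(x)$ and $\mathsf{right}_j(x)$ (the last $v$-leaf to the left, resp. the first $v$-leaf to the right, of the subtree rooted at $x$ is $v_j$), and with Lindström quantifiers $Q_Kx\cdot\langle\varphi_\delta\rangle_{\delta\in\Delta}$. In the latter $K\subseteq\Delta M_k$, $\Delta_n\neq\emptyset$ whenever $\Sigma_n\ne\emptyset$, and the family is deterministic: for each $t\in\Sigma M_k$ and each interpretation sending $x$ to a node of rank $n$, exactly one $\varphi_\delta$ with $\delta\in\Delta_n$ holds. The quantified formula holds if the tree obtained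 from $t$ by relabeling each node $p\in \mathsf{NV}(t)$, say of rank $n$, by the $\delta\in\Delta_n$ such that $\varphi_\delta$ holds for $x\mapsto p$, belongs to $K$. For a class $\mathcal K$ of tree languages, $\mathbf{Lind}(\mathcal K)$ is the set of formulas whose quantifiers are all of the form $Q_K$ with $K\in\mathcal K$. A language $L\subseteq\Sigma M_k$ belongs to $\mathcal Lind(\mathcal K)$ if some $\mathbf{Lind}(\mathcal K)$-sentence of rank $k$ over $\Sigma$ is satisfied by exactly the trees of $L\setminus\{\mathbf 1\}$ among the trees $t\neq\mathbf 1$ of $\Sigma M_k$. **Relativization.** $\mathbf{Lind}(\mathcal K)$ admits relativization if the following hold for every ranked alphabet $\Sigma$. (R1) For all $k\ge k_1+k_2$ and each sentence $\varphi\in\mathbf{Lind}(\mathcal K)$ of rank $k_1+1+k_2$ over $\Sigma$ there is a $\mathbf{Lind}(\mathcal K)$-formula $\psi(x)$ of rank $k$ such that for all $t\in\Sigma M_k$ and $p\in\mathsf{NV}(t)$: $(t,x\mapsto p)\models\psi$ if and only if $t=r\cdot(\mathbf k_1\oplus s\oplus\mathbf k_2)$, where $s$ is the subtree of $t$ rooted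 at $p$ and is attached at $p$, and $r\models\varphi$. (R2) For all $k_1,k_2,\ell\ge0$, all $i\ge1$ not exceeding the maximal rank of a letter of $\Sigma$, and each sentence $\varphi\in\mathbf{Lind}(\mathcal K)$ of rank $\ell$ over $\Sigma$ there is a $\mathbf{Lind}(\mathcal K)$-formula $\psi(x)$ of rank $k_1+\ell+k_2$ such that for all $t\in\Sigma M_{k_1+\ell+k_2}$ and $p\in\mathsf{NV}(t)$: $(t,x\mapsto p)\models\psi$ if and only if $p$ has an $i$-th child $w$, $t=r\cdot(\mathbf k_1\oplus s\oplus\mathbf k_2)$, where $s$ is the subtree of $t$ rooted at $w$, has rank $\ell$ and is attached at $w$, and $s\models\varphi$. (Nothing is required in the cases where $r=\mathbf 1$ in (R1) or $s=\mathbf 1$ in (R2), since formulas are not interpreted on $\mathbf 1$.) **Proposition.** Let $\mathcal K$ be a class of recognizable tree languages such that $\mathbf{Lind}(\mathcal K)$ admits relativization, and let $(S,A)$ and $(T,B)$ be finitary pg-pairs such that every tree language recognized by $(S,A)$ or by $(T,B)$ belongs to $\mathcal Lind(\mathcal K)$. Then, for every $k\ge0$, every tree language that is recognized by the block product $(S,A)\,\square_k\,(T,B)$,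 over a ranked alphabet $\Sigma$ such that $A_m\ne\emptyset$ whenever $\Sigma_m\neq\emptyset$, belongs to $\mathcal Lind(\mathcal K)$. -/

import Mathlib

universe u v

/-! ### Preclones -/

/-- A preclone. The many-sorted algebra `(S_n)_{n ≥ 0}` is presented by the disjoint union `S` of
its sorts together with the rank function, so that `S_n = {s | rank s = n}`. A tuple
`g = g_1 ⊕ ⋯ ⊕ g_n` that can be composed under `f ∈ S_n` is a function `Fin (rank f) → S`, and
`comp f g` is the element `f · g`. In `comp_assoc` the tuple `h` has length `∑ i, rank (g i)`, and
`fun j => h (finSigmaFinEquiv ⟨i, j⟩)` is its `i`-th consecutive block, of length `rank (g i)`. -/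
class Preclone (S : Type u) where
  rank : S → ℕ
  one : S
  comp : (f : S) → (Fin (rank f) → S) → S
  rank_one : rank one = 1
  rank_comp : ∀ (f : S) (g : Fin (rank f) → S), rank (comp f g) = ∑ i, rank (g i)
  one_comp : ∀ f : S, comp one (fun _ => f) = f
  comp_one : ∀ f : S, comp f (fun _ => one) = f
  comp_assoc : ∀ (f : S) (g : Fin (rank f) → S) (h : Fin (∑ i, rank (g i)) → S),
    comp (comp f g) (fun j => h (Fin.cast (rank_comp f g) j)) =
      comp f (fun i => comp (g i) (fun j => h (finSigmaFinEquiv ⟨i, j⟩)))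

namespace Preclone

/-- A preclone is finitary if each `S_n` is finite. -/
def Finitary (S : Type u) [Preclone S] : Prop :=
  ∀ n : ℕ, {s : S | rank s = n}.Finite

/-- Morphisms of preclones: rank preserving maps that preserve the unit and the composition. -/
structure IsMorphism {S : Type u} {T : Type v} [Preclone S] [Preclone T] (φ : S → T) : Prop where
  map_rank : ∀ s, rank (φ s) = rank s
  map_one : φ one = one
  map_comp : ∀ (f : S) (g : Fin (rank f) → S),
    φ (comp f g) = comp (φ f) (fun i => φ (g (Fin.cast (map_rank f) i)))

/-- Membership in the least sub-preclone containing `A`. -/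
inductive Closure {S : Type u} [Preclone S] (A : Set S) : S → Prop
  | of {a : S} : a ∈ A → Closure A a
  | one : Closure A Preclone.one
  | comp {f : S} {g : Fin (rank f) → S} :
      Closure A f → (∀ i, Closure A (g i)) → Closure A (Preclone.comp f g)

/-- The sub-preclone generated by `A`. -/
instance closurePreclone {S : Type u} [Preclone S] (A : Set S) :
    Preclone {s : S // Closure A s} where
  rank s := rank s.1
  one := ⟨one, .one⟩
  comp f g := ⟨comp f.1 (fun i => (g i).1), .comp f.2 (fun i => (g i).2)⟩
  rank_one := rank_one
  rank_comp f g := rank_comp f.1 _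
  one_comp f := Subtype.ext (one_comp f.1)
  comp_one f := Subtype.ext (comp_one f.1)
  comp_assoc f g h := Subtype.ext (comp_assoc f.1 (fun i => (g i).1) (fun j => (h j).1))

/-- `plug u p x` is `u · (𝐩 ⊕ x ⊕ 𝐪)` where `rank u = p + 1 + q`: the element `x` is attached
at the argument of `u` number `p`, counting from `0`, and the unit at all others. -/
def plug {S : Type u} [Preclone S] (u : S) (p : ℕ) (x : S) : S :=
  comp u (fun i => if (i : ℕ) = p then x else one)

section lemmas

variable {S : Type u} [Preclone S]

lemma comp_congr {f f' : S} (hf : f = f') (g : Fin (rank f) → S) (g' : Fin (rank f') → S)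
    (h : ∀ i, g i = g' (Fin.cast (congrArg rank hf) i)) : comp f g = comp f' g' := by
  subst hf
  congr 1
  funext i
  exact h i

lemma comp_assoc' (f : S) (g : Fin (rank f) → S) (h : Fin (rank (comp f g)) → S) :
    comp (comp f g) h =
      comp f (fun i => comp (g i)
        (fun j => h (Fin.cast (rank_comp f g).symm (finSigmaFinEquiv ⟨i, j⟩)))) := by
  rw [← comp_assoc f g (fun j => h (Fin.cast (rank_comp f g).symm j))]
  rfl

lemma sum_sigma_fin {M : Type*} [AddCommMonoid M] {n : ℕ} {m : Fin n → ℕ}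
    (F : Fin (∑ i, m i) → M) :
    ∑ j, F j = ∑ i, ∑ j, F (finSigmaFinEquiv ⟨i, j⟩) := by
  rw [← Equiv.sum_comp finSigmaFinEquiv F, ← Finset.univ_sigma_univ, Finset.sum_sigma]

lemma sum_Iio_eq {n : ℕ} (m : Fin n → ℕ) (i : Fin n) :
    ∑ j ∈ Finset.Iio i, m j = ∑ j : Fin i, m (Fin.castLE i.2.le j) := by
  symm
  refine Finset.sum_bij (fun j _ => Fin.castLE i.2.le j) ?_ ?_ ?_ ?_
  · intro j _
    simp only [Finset.mem_Iio, Fin.lt_def, Fin.val_castLE]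
    exact j.2
  · intro a _ b _ h
    simpa [Fin.ext_iff] using h
  · intro b hb
    simp only [Finset.mem_Iio, Fin.lt_def] at hb
    exact ⟨⟨b, hb⟩, Finset.mem_univ _, rfl⟩
  · intros; rfl

lemma sigma_val {n : ℕ} (m : Fin n → ℕ) (i : Fin n) (j : Fin (m i)) :
    ((finSigmaFinEquiv ⟨i, j⟩ : Fin (∑ i, m i)) : ℕ) = ∑ l ∈ Finset.Iio i, m l + j := by
  rw [finSigmaFinEquiv_apply, sum_Iio_eq]

lemma sum_split {n : ℕ} (m : Fin n → ℕ) (i : Fin n) :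
    ∑ j, m j = ∑ j ∈ Finset.Iio i, m j + m i + ∑ j ∈ Finset.Ioi i, m j := by
  have h : (Finset.univ : Finset (Fin n)) = (Finset.Iio i ∪ {i}) ∪ Finset.Ioi i := by
    ext j
    simp only [Finset.mem_univ, Finset.mem_union, Finset.mem_Iio, Finset.mem_singleton,
      Finset.mem_Ioi, true_iff]
    rcases lt_trichotomy j i with h | h | h <;> simp [h]
  rw [h, Finset.sum_union, Finset.sum_union, Finset.sum_singleton]
  · rw [Finset.disjoint_left]
    intro j hj
    rw [Finset.mem_Iio] at hj
    rw [Finset.mem_singleton]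
    exact hj.ne
  · rw [Finset.disjoint_left]
    intro j hj
    simp only [Finset.mem_union, Finset.mem_Iio, Finset.mem_singleton] at hj
    simp only [Finset.mem_Ioi, not_lt]
    rcases hj with hj | hj
    · exact hj.le
    · exact hj.le

lemma sigma_lt {n : ℕ} {m : Fin n → ℕ} (i i' : Fin n) (l : Fin (m i)) (l' : Fin (m i'))
    (h : i' < i) : finSigmaFinEquiv ⟨i', l'⟩ < finSigmaFinEquiv ⟨i, l⟩ := by
  rw [Fin.lt_def, sigma_val, sigma_val]
  have h1 : ∑ j ∈ Finset.Iio i', m j + m i' ≤ ∑ j ∈ Finset.Iio i, m j := by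
    rw [add_comm, ← Finset.sum_insert (by simp)]
    apply Finset.sum_le_sum_of_subset
    intro j hj
    simp only [Finset.mem_insert, Finset.mem_Iio] at hj ⊢
    rcases hj with rfl | hj
    · exact h
    · exact hj.trans h
  have := l'.2
  omega

lemma sum_Iio_sigma {n : ℕ} {m : Fin n → ℕ} (F : Fin (∑ i, m i) → ℕ) (i : Fin n)
    (l : Fin (m i)) :
    ∑ p ∈ Finset.Iio (finSigmaFinEquiv ⟨i, l⟩), F p =
      ∑ i' ∈ Finset.Iio i, ∑ l', F (finSigmaFinEquiv ⟨i', l'⟩) +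
        ∑ l' ∈ Finset.Iio l, F (finSigmaFinEquiv ⟨i, l'⟩) := by
  have h0 : ∀ {N : ℕ} (p : Fin N) (G : Fin N → ℕ),
      ∑ q ∈ Finset.Iio p, G q = ∑ q, if q < p then G q else 0 := by
    intro N p G
    rw [← Finset.sum_filter]
    congr 1
    ext q
    simp
  rw [h0, sum_sigma_fin, sum_split _ i]
  have h1 : ∑ j ∈ Finset.Ioi i, ∑ l', (if (finSigmaFinEquiv ⟨j, l'⟩ : Fin (∑ i, m i)) <
      finSigmaFinEquiv ⟨i, l⟩ then F (finSigmaFinEquiv ⟨j, l'⟩) else 0) = 0 := by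
    refine Finset.sum_eq_zero fun j hj => Finset.sum_eq_zero fun l' _ => ?_
    rw [if_neg (not_lt.2 (sigma_lt _ _ _ _ (Finset.mem_Ioi.1 hj)).le)]
  rw [h1, add_zero]
  congr 1
  · refine Finset.sum_congr rfl fun j hj => Finset.sum_congr rfl fun l' _ => ?_
    rw [if_pos (sigma_lt _ _ _ _ (Finset.mem_Iio.1 hj))]
  · rw [h0]
    refine Finset.sum_congr rfl fun l' _ => ?_
    have : (finSigmaFinEquiv ⟨i, l'⟩ : Fin (∑ i, m i)) < finSigmaFinEquiv ⟨i, l⟩ ↔ l' < l := by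
      rw [Fin.lt_def, sigma_val, sigma_val, Fin.lt_def]
      omega
    simp only [this]

lemma rank_plug (u : S) (p q : ℕ) (x : S) (h : rank u = p + 1 + q) :
    rank (plug u p x) = p + rank x + q := by
  unfold plug
  rw [rank_comp]
  have hp : p < rank u := by omega
  rw [sum_split _ ⟨p, hp⟩]
  rw [Finset.sum_congr rfl (g := fun _ => 1), Finset.sum_congr (s₁ := Finset.Ioi _) rfl
    (g := fun _ => 1)]
  · simp; omega
  · intro i hi
    simp only [Finset.mem_Ioi, Fin.lt_def] at hi
    rw [if_neg (by omega), rank_one]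
  · intro i hi
    simp only [Finset.mem_Iio, Fin.lt_def] at hi
    rw [if_neg (by omega), rank_one]

/-- Plugging inside the `i`-th component of a composition. -/
lemma plug_comp (f : S) (g : Fin (rank f) → S) (i : Fin (rank f)) (q : Fin (rank (g i))) (y : S)
    (p : ℕ) (hp : p = ∑ l ∈ Finset.Iio i, rank (g l) + q) :
    plug (comp f g) p y = comp f (fun j => if j = i then plug (g i) q y else g j) := by
  subst hp
  conv_lhs => unfold plug
  rw [comp_assoc']
  congr 1
  funext j
  have key : ∀ l : Fin (rank (g j)), ((finSigmaFinEquiv ⟨j, l⟩ : Fin (∑ i, rank (g i))) : ℕ) =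
      ∑ l ∈ Finset.Iio i, rank (g l) + q ↔ j = i ∧ (l : ℕ) = q := by
    intro l
    constructor
    · intro h
      rw [← sigma_val (fun i => rank (g i)) i q] at h
      have := finSigmaFinEquiv.injective (Fin.ext h)
      rw [Sigma.mk.injEq] at this
      obtain ⟨rfl, h2⟩ := this
      exact ⟨rfl, by rw [eq_of_heq h2]⟩
    · rintro ⟨rfl, h2⟩
      rw [sigma_val, h2]
  simp only [Fin.val_cast, key]
  by_cases hj : j = i
  · subst hj
    simp [plug]
  · simp [hj, comp_one]

lemma plug_one (y : S) : plug one 0 y = y := by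
  unfold plug
  conv_rhs => rw [← one_comp y]
  congr 1
  funext i
  have h := i.2
  have h1 := rank_one (S := S)
  rw [if_pos (by omega)]

lemma plug_comp_one (f : S) (g : Fin (rank f) → S) (i : Fin (rank f)) (y : S)
    (p : ℕ) (hp : p = ∑ l ∈ Finset.Iio i, rank (g l)) (hi : g i = one) :
    plug (comp f g) p y = comp f (fun j => if j = i then y else g j) := by
  have h : 0 < rank (g i) := by rw [hi, rank_one]; exact Nat.one_pos
  rw [plug_comp f g i ⟨0, h⟩ y p hp]
  have e : plug (g i) 0 y = y := by rw [hi, plug_one]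
  change comp f (fun j => if j = i then plug (g i) 0 y else g j) = _
  rw [e]

lemma plug_plug (u : S) (p : ℕ) (hu : p < rank u) (x : S) (q : ℕ) (hq : q < rank x) (y : S) :
    plug (plug u p x) (p + q) y = plug u p (plug x q y) := by
  have e : (if ((⟨p, hu⟩ : Fin (rank u)) : ℕ) = p then x else one) = x := if_pos rfl
  conv_lhs => rw [plug.eq_1 u p x]
  rw [plug_comp u _ ⟨p, hu⟩ ⟨q, by rw [e]; exact hq⟩]
  · unfold plug
    congr 1
    funext i
    by_cases hi : (i : ℕ) = p
    · have : i = ⟨p, hu⟩ := Fin.ext hi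
      rw [if_pos this, if_pos hi]
      exact comp_congr e _ _ fun _ => rfl
    · have : i ≠ ⟨p, hu⟩ := fun h => hi (by rw [h])
      simp [hi, this]
  · rw [Finset.sum_congr rfl (g := fun _ => 1)]
    · simp
    · intro i hi
      simp only [Finset.mem_Iio, Fin.lt_def] at hi
      rw [if_neg (by omega), rank_one]

lemma comp_assoc_cast {N : ℕ} (F : S) (hN : rank F = N) (m : Fin N → ℕ) (A : Fin N → S)
    (hA : ∀ i, rank (A i) = m i) (B : Fin (∑ i, m i) → S)
    (e : rank (comp F (fun i => A (Fin.cast hN i))) = ∑ i, m i) :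
    comp (comp F (fun i => A (Fin.cast hN i))) (fun p => B (Fin.cast e p)) =
      comp F (fun i => comp (A (Fin.cast hN i))
        (fun l => B (finSigmaFinEquiv ⟨Fin.cast hN i, Fin.cast (hA _) l⟩))) := by
  obtain rfl : m = fun i => rank (A i) := funext fun i => (hA i).symm
  subst hN
  exact comp_assoc F A B

end lemmas

end Preclone

open Preclone

/-! ### Preclone-generator pairs -/

/-- A preclone-generator pair. -/
structure PGPair where
  Carrier : Type u
  [preclone : Preclone Carrier]
  gens : Set Carrier
  generates : ∀ s, Closure gens s

attribute [instance] PGPair.preclone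

/-- A pg-pair `(S, A)` is finitary if `S` is finitary and `A` is finite. -/
def PGPair.Finitary (P : PGPair.{u}) : Prop :=
  Preclone.Finitary P.Carrier ∧ P.gens.Finite

/-- The sub-preclone of `S` generated by `A`, with the generating set `A`. -/
def PGPair.generatedBy {S : Type u} [Preclone S] (A : Set S) : PGPair.{u} where
  Carrier := {s : S // Closure A s}
  gens := {s | s.1 ∈ A}
  generates := by
    rintro ⟨s, hs⟩
    induction hs with
    | of h => exact .of h
    | one => exact .one
    | @comp f g hf hg ihf ihg =>
      exact Closure.comp (S := {s : S // Closure A s}) (f := ⟨f, hf⟩)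
        (g := fun i => ⟨g i, hg i⟩) ihf ihg

/-! ### The block product -/

/-- The set `I_{k,n}` of `n`-ary contexts `(u, k₁, v, k₂)` in `T_k`. -/
@[ext]
structure Context (T : Type v) [Preclone T] (k n : ℕ) where
  u : T
  k₁ : ℕ
  v : Fin n → T
  k₂ : ℕ
  rank_u : rank u = k₁ + 1 + k₂
  total : k₁ + ∑ i, rank (v i) + k₂ = k

namespace Context

variable {T : Type v} [Preclone T] {k : ℕ}

/-- Transport along an equality of arities. -/
def cast {n n' : ℕ} (h : n = n') (C : Context T k n) : Context T k n' where
  u := C.u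
  k₁ := C.k₁
  v := fun i => C.v (Fin.cast h.symm i)
  k₂ := C.k₂
  rank_u := C.rank_u
  total := by subst h; exact C.total

section

variable {f : T} {g : Fin (rank f) → T}

/-- The block `v̄_i` of the entries of `v` that are attached under `g_i`. -/
def block (C : Context T k (rank (comp f g))) (i : Fin (rank f)) : Fin (rank (g i)) → T :=
  fun j => C.v (Fin.cast (rank_comp f g).symm (finSigmaFinEquiv ⟨i, j⟩))

lemma total_block (C : Context T k (rank (comp f g))) :
    C.k₁ + ∑ i, ∑ j, rank (C.block i j) + C.k₂ = k := by
  refine Eq.trans ?_ C.total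
  congr 2
  rw [← Equiv.sum_comp (finCongr (rank_comp f g).symm), sum_sigma_fin]
  rfl

/-- From `(u, k₁, v, k₂)`, a context of `f · g`, to the context `(u, k₁, g · v, k₂)` of `f`. -/
def above (C : Context T k (rank (comp f g))) : Context T k (rank f) where
  u := C.u
  k₁ := C.k₁
  v := fun i => comp (g i) (C.block i)
  k₂ := C.k₂
  rank_u := C.rank_u
  total := by simpa only [rank_comp] using C.total_block

/-- From `(u, k₁, v, k₂)`, a context of `f · g`, to the context `C_i = (c_i, p₁, v̄_i, p₂)` of
`g_i`. -/
def below (C : Context T k (rank (comp f g))) (i : Fin (rank f)) : Context T k (rank (g i)) where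
  u := plug C.u C.k₁ (comp f (fun j => if j = i then one else comp (g j) (C.block j)))
  k₁ := C.k₁ + ∑ j ∈ Finset.Iio i, ∑ l, rank (C.block j l)
  v := C.block i
  k₂ := ∑ j ∈ Finset.Ioi i, ∑ l, rank (C.block j l) + C.k₂
  rank_u := by
    rw [rank_plug _ _ _ _ C.rank_u, rank_comp f (fun j => if j = i then _ else _), sum_split _ i]
    rw [Finset.sum_congr rfl (g := fun j => ∑ l, rank (C.block j l)),
      Finset.sum_congr (s₁ := Finset.Ioi _) rfl (g := fun j => ∑ l, rank (C.block j l))]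
    · simp only [if_true, rank_one]
      omega
    · intro j hj
      rw [Finset.mem_Ioi] at hj
      rw [if_neg hj.ne', rank_comp]
    · intro j hj
      rw [Finset.mem_Iio] at hj
      rw [if_neg hj.ne, rank_comp]
  total := by
    have h := C.total_block
    rw [sum_split _ i] at h
    omega

end

end Context

/-- The underlying set of the block product `S □_k T`: its elements of rank `n` are the pairs
`(F, f)` with `f ∈ T_n` and `F : I_{k,n} → S_n`. -/
structure BlockProduct (k : ℕ) (S : Type u) (T : Type v) [Preclone S] [Preclone T] where
  snd : T
  fst : Context T k (rank snd) → S
  rank_fst : ∀ C, rank (fst C) = rank snd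

namespace BlockProduct

variable {k : ℕ} {S : Type u} {T : Type v} [Preclone S] [Preclone T]

lemma ext' {X Y : BlockProduct k S T} (h : X.snd = Y.snd)
    (hF : ∀ C, X.fst C = Y.fst (C.cast (congrArg rank h))) : X = Y := by
  obtain ⟨f, F, hf⟩ := X
  obtain ⟨f', F', hf'⟩ := Y
  dsimp only at h
  subst h
  congr 1
  funext C
  exact hF C

/-- The composition of the block product:
`Q(C) = F(u, k₁, g · v, k₂) · (G_1(C_1) ⊕ ⋯ ⊕ G_n(C_n))` for a context `C = (u, k₁, v, k₂)`. -/
def mul (X : BlockProduct k S T) (G : Fin (rank X.snd) → BlockProduct k S T) :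
    BlockProduct k S T where
  snd := comp X.snd (fun i => (G i).snd)
  fst := fun C => comp (X.fst C.above)
    (fun i => (G (Fin.cast (X.rank_fst _) i)).fst (C.below (Fin.cast (X.rank_fst _) i)))
  rank_fst := by
    intro C
    rw [rank_comp, rank_comp, ← Equiv.sum_comp (finCongr (X.rank_fst C.above))]
    exact Finset.sum_congr rfl (fun i _ => rank_fst _ _)

lemma comp_one_eq (w : Fin (rank (one : T)) → T) (i : Fin (rank (one : T))) :
    comp one w = w i := by
  conv_rhs => rw [← one_comp (w i)]
  congr 1
  funext j
  have h := i.2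
  have h' := j.2
  have h1 := rank_one (S := T)
  congr 1
  ext
  omega

lemma sum_rank_one_Iio {n : ℕ} (i : Fin n) : ∑ _l ∈ Finset.Iio i, rank (one : T) = i := by
  simp [rank_one]

lemma context_above_one (f : T) (C : Context T k (rank (comp f (fun _ => one)))) :
    C.above = C.cast (congrArg rank (comp_one f)) := by
  refine Context.ext rfl rfl ?_ rfl
  funext i
  have h : 0 < rank (one : T) := by rw [rank_one]; exact Nat.one_pos
  change comp one (C.block i) = _
  rw [comp_one_eq _ ⟨0, h⟩]
  change C.v _ = C.v _
  congr 1
  ext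
  rw [Fin.val_cast, Fin.val_cast]
  refine (sigma_val (fun _ => rank (one : T)) i ⟨0, h⟩).trans ?_
  rw [sum_rank_one_Iio]
  rfl

lemma context_below_one (g : T) (C : Context T k (rank (comp one (fun _ => g))))
    (i : Fin (rank (one : T))) :
    C.below i = C.cast (congrArg rank (one_comp g)) := by
  have h1 := rank_one (S := T)
  have hi := i.2
  have hIio : Finset.Iio i = ∅ := by
    ext j
    simp only [Finset.mem_Iio, Fin.lt_def, Finset.notMem_empty, iff_false]
    omega
  have hIoi : Finset.Ioi i = ∅ := by
    ext j
    have := j.2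
    simp only [Finset.mem_Ioi, Fin.lt_def, Finset.notMem_empty, iff_false]
    omega
  refine Context.ext ?_ ?_ ?_ ?_
  · change plug C.u C.k₁ _ = C.u
    refine (congrArg (plug C.u C.k₁) (comp_one_eq _ i)).trans ?_
    rw [if_pos rfl]
    unfold plug
    conv_rhs => rw [← comp_one C.u]
    simp
  · simp [Context.below, Context.cast, hIio]
  · funext j
    change C.v _ = C.v _
    congr 1
    ext
    rw [Fin.val_cast, Fin.val_cast]
    refine (sigma_val (fun _ => rank g) i j).trans ?_
    rw [hIio, Finset.sum_empty, Nat.zero_add]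
  · simp [Context.below, Context.cast, hIoi]

lemma context_ext {n : ℕ} {C D : Context T k n} (hu : C.u = D.u) (h₁ : C.k₁ = D.k₁)
    (hv : C.v = D.v) : C = D := by
  refine Context.ext hu h₁ hv ?_
  have hC := C.total
  have hD := D.total
  rw [hv, h₁] at hC
  omega

lemma sum_Iio_cast {n n' : ℕ} (e : n = n') (F : Fin n' → ℕ) (i : Fin n') :
    ∑ p ∈ Finset.Iio (Fin.cast e.symm i), F (Fin.cast e p) = ∑ p ∈ Finset.Iio i, F p := by
  subst e
  rfl

section assoc

variable {f : T} {g : Fin (rank f) → T} {h : Fin (∑ i, rank (g i)) → T}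

/-- The block of `h` under `g_i`. -/
abbrev hblock (h : Fin (∑ i, rank (g i)) → T) (i : Fin (rank f)) : Fin (rank (g i)) → T :=
  fun j => h (finSigmaFinEquiv ⟨i, j⟩)

/-- The position of the `l`-th variable of `g_i` among the variables of `f · g`. -/
abbrev pos (g : Fin (rank f) → T) (i : Fin (rank f)) (l : Fin (rank (g i))) :
    Fin (rank (comp f g)) :=
  Fin.cast (rank_comp f g).symm (finSigmaFinEquiv ⟨i, l⟩)

variable
  (C : Context T k (rank (comp (comp f g) (fun j => h (Fin.cast (rank_comp f g) j)))))

lemma block_block (i : Fin (rank f)) (l : Fin (rank (g i))) :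
    Context.block (g := hblock h i)
      (Context.below (g := fun i => comp (g i) (hblock h i))
        (C.cast (congrArg rank (comp_assoc f g h))) i) l = C.block (pos g i l) := by
  funext j
  change C.v _ = C.v _
  congr 1
  ext
  simp only [Fin.val_cast]
  refine (sigma_val (fun i => rank (comp (g i) (hblock h i))) i _).trans ?_
  rw [Fin.val_cast]
  refine (congrArg _ (sigma_val (fun l => rank (hblock h i l)) l j)).trans ?_
  refine Eq.trans ?_ (sigma_val (fun p => rank (h (Fin.cast (rank_comp f g) p))) (pos g i l) j).symm
  have e : ∑ p ∈ Finset.Iio (pos g i l), rank (h (Fin.cast (rank_comp f g) p)) =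
      ∑ p ∈ Finset.Iio (finSigmaFinEquiv ⟨i, l⟩), rank (h p) :=
    sum_Iio_cast (rank_comp f g) (fun p => rank (h p)) _
  rw [e, sum_Iio_sigma, ← Nat.add_assoc]
  simp only [rank_comp]

lemma sum_rank_block (i : Fin (rank f)) :
    ∑ q, rank (Context.block (g := fun i => comp (g i) (hblock h i))
        (C.cast (congrArg rank (comp_assoc f g h))) i q) =
      ∑ l, ∑ r, rank (C.block (pos g i l) r) := by
  rw [← Equiv.sum_comp (finCongr (rank_comp (g i) (hblock h i)).symm), sum_sigma_fin]
  refine Finset.sum_congr rfl fun l _ => Finset.sum_congr rfl fun r _ => ?_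
  rw [← block_block]
  rfl

lemma above_block (i : Fin (rank f)) :
    comp (g i) (C.above.block i) = comp (comp (g i) (hblock h i))
      (Context.block (g := fun i => comp (g i) (hblock h i))
        (C.cast (congrArg rank (comp_assoc f g h))) i) := by
  rw [comp_assoc']
  congr 1
  funext l
  change comp (hblock h i l) (C.block (pos g i l)) = _
  rw [← block_block]
  rfl

lemma above_above : C.above.above =
    Context.above (g := fun i => comp (g i) (hblock h i))
      (C.cast (congrArg rank (comp_assoc f g h))) := by
  refine context_ext rfl rfl ?_
  funext i
  exact above_block C i

lemma above_below (i : Fin (rank f)) : C.above.below i =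
    Context.above (g := hblock h i) (Context.below (g := fun i => comp (g i) (hblock h i))
      (C.cast (congrArg rank (comp_assoc f g h))) i) := by
  refine context_ext ?_ ?_ ?_
  · change plug C.u C.k₁ _ = plug C.u C.k₁ _
    simp only [above_block]
  · change C.k₁ + _ = C.k₁ + _
    congr 1
    refine Finset.sum_congr rfl fun j _ => ?_
    rw [sum_rank_block]
    exact Finset.sum_congr rfl fun l _ => rank_comp _ _
  · funext l
    change comp (hblock h i l) (C.block (pos g i l)) = comp (hblock h i l) _
    rw [block_block]

lemma below_below (i : Fin (rank f)) (l : Fin (rank (g i))) : C.below (pos g i l) =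
    Context.below (g := hblock h i) (Context.below (g := fun i => comp (g i) (hblock h i))
      (C.cast (congrArg rank (comp_assoc f g h))) i) l := by
  refine context_ext ?_ ?_ ?_
  · change plug C.u C.k₁ _ = plug (plug C.u C.k₁ _) (C.k₁ + _) _
    have hu := C.rank_u
    rw [plug_plug _ _ (by omega)]
    · congr 1
      rw [plug_comp_one f _ i]
      · rw [comp_assoc']
        congr 1
        funext i'
        by_cases hi : i' = i
        · subst hi
          rw [if_pos rfl]
          congr 1
          funext l'
          rw [block_block]
          have : pos g i' l' = pos g i' l ↔ l' = l := by
            constructor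
            · intro hh
              have := finSigmaFinEquiv.injective (Fin.cast_injective _ hh)
              simpa using this
            · rintro rfl; rfl
          simp only [this]
          rfl
        · rw [if_neg hi, if_neg hi, ← above_block]
          congr 1
          funext l'
          have : pos g i' l' ≠ pos g i l := by
            intro hh
            have := finSigmaFinEquiv.injective (Fin.cast_injective _ hh)
            rw [Sigma.mk.injEq] at this
            exact hi this.1
          rw [if_neg this]
          rfl
      · refine Finset.sum_congr rfl fun j hj => ?_
        rw [if_neg (Finset.mem_Iio.1 hj).ne]
        exact (rank_comp _ _).symm
      · rw [if_pos rfl]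
    · refine lt_of_lt_of_eq ?_ ((rank_comp f _).trans (sum_split _ i)).symm
      have e : ∑ j ∈ Finset.Iio i, ∑ q, rank (Context.block
          (g := fun i => comp (g i) (hblock h i))
          (C.cast (congrArg rank (comp_assoc f g h))) j q) =
          ∑ j ∈ Finset.Iio i, rank (if j = i then one else comp (comp (g j) (hblock h j))
            (Context.block (g := fun i => comp (g i) (hblock h i))
              (C.cast (congrArg rank (comp_assoc f g h))) j)) := by
        refine Finset.sum_congr rfl fun j hj => ?_
        rw [if_neg (Finset.mem_Iio.1 hj).ne]
        exact (rank_comp _ _).symm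
      rw [e, if_pos rfl, rank_one]
      exact Nat.lt_of_lt_of_le (Nat.lt_succ_self _) (Nat.le_add_right _ _)
  · change C.k₁ + _ = C.k₁ + _ + _
    rw [Nat.add_assoc]
    congr 1
    refine (sum_Iio_cast (rank_comp f g)
      (fun p => ∑ r, rank (C.block (Fin.cast (rank_comp f g).symm p) r)) _).trans ?_
    refine (sum_Iio_sigma _ _ _).trans ?_
    congr 1
    · refine Finset.sum_congr rfl fun j _ => ?_
      rw [sum_rank_block]
    · refine Finset.sum_congr rfl fun l' _ => ?_
      rw [block_block]
      rfl
  · exact (block_block C i l).symm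

end assoc

/-- The block product `S □_k T` is a preclone. -/
instance : Preclone (BlockProduct k S T) where
  rank X := rank X.snd
  one := { snd := one, fst := fun _ => one, rank_fst := fun _ => by rw [rank_one, rank_one] }
  comp := mul
  rank_one := rank_one
  rank_comp X G := rank_comp X.snd _
  one_comp X := by
    refine ext' (one_comp X.snd) fun C => ?_
    refine Eq.trans ?_ (one_comp _)
    exact congrArg (comp one) (funext fun i => congrArg X.fst (context_below_one X.snd C _))
  comp_one X := by
    refine ext' (comp_one X.snd) fun C => ?_
    exact (comp_one _).trans (congrArg X.fst (context_above_one X.snd C))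
  comp_assoc X G H := by
    refine ext' (comp_assoc X.snd (fun i => (G i).snd) (fun j => (H j).snd)) fun C => ?_
    refine (comp_assoc_cast _ (X.rank_fst _) (fun i => rank (G i).snd)
      (fun i => (G i).fst (Context.below (Context.above C) i))
      (fun i => (G i).rank_fst _)
      (fun p => (H p).fst (Context.below (g := fun p => (H (Fin.cast _ p)).snd) C
        (Fin.cast (rank_comp X.snd (fun i => (G i).snd)).symm p))) ?_).trans ?_
    · refine (rank_comp _ _).trans ?_
      refine (Finset.sum_congr rfl fun i _ => (G _).rank_fst _).trans ?_
      exact Equiv.sum_comp (finCongr (X.rank_fst _)) (fun i => rank (G i).snd)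
    refine comp_congr (congrArg X.fst (above_above (f := X.snd) (g := fun i => (G i).snd)
      (h := fun j => (H j).snd) C)) _ _ fun i => ?_
    refine comp_congr (congrArg (G _).fst (above_below (f := X.snd) (g := fun i => (G i).snd)
      (h := fun j => (H j).snd) C _)) _ _ fun l => ?_
    exact congrArg (H _).fst (below_below (f := X.snd) (g := fun i => (G i).snd)
      (h := fun j => (H j).snd) C _ _)

end BlockProduct

/-- The block product `(S, A) □_k (T, B)`: the sub-pg-pair of `S □_k T` generated by the pairs
`(F, g)` such that `g ∈ B` and all the values of `F` are in `A`. -/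
def PGPair.blockProduct (k : ℕ) (P : PGPair.{u}) (Q : PGPair.{v}) : PGPair.{max u v} :=
  PGPair.generatedBy
    {X : BlockProduct k P.Carrier Q.Carrier | X.snd ∈ Q.gens ∧ ∀ C, X.fst C ∈ P.gens}

/-! ### Trees and tree languages -/

/-- A ranked alphabet: the sets of letters of rank `n`, with finitely many letters in all. -/
structure RankedAlphabet where
  Letter : ℕ → Type
  finite : Finite (Σ n, Letter n)

/-- Trees whose inner nodes and constants carry letters and whose other leaves are variables.
A tree with `n` variable leaves stands for the element of rank `n` of the free preclone in which
these leaves are labeled `v_1, …, v_n` from left to right; so the labels need not be written. -/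
inductive RTree (A : ℕ → Type) : Type
  | var : RTree A
  | node {n : ℕ} (a : A n) (ts : Fin n → RTree A) : RTree A

namespace RTree

variable {A : ℕ → Type}

/-- The number of variable leaves. -/
def numVars : RTree A → ℕ
  | var => 1
  | node _ ts => ∑ i, (ts i).numVars

/-- Substitution of the trees `g j` for the variable leaves, from left to right. -/
def subst : (t : RTree A) → (Fin t.numVars → RTree A) → RTree A
  | var, g => g ⟨0, Nat.one_pos⟩
  | node a ts, g => node a (fun i => (ts i).subst (fun j => g (finSigmaFinEquiv ⟨i, j⟩)))

lemma numVars_subst : ∀ (t : RTree A) (g : Fin t.numVars → RTree A),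
    (t.subst g).numVars = ∑ i, (g i).numVars
  | var, g => (Fin.sum_univ_one (fun i : Fin 1 => (g i).numVars)).symm
  | node a ts, g => by
    refine Eq.trans ?_ (sum_sigma_fin (fun i => (g i).numVars)).symm
    exact Finset.sum_congr rfl fun i _ => numVars_subst (ts i) _

lemma subst_var : ∀ t : RTree A, t.subst (fun _ => var) = t
  | var => rfl
  | node a ts => congrArg (node a) (funext fun i => subst_var (ts i))

lemma subst_subst : ∀ (t : RTree A) (g : Fin t.numVars → RTree A)
    (h : Fin (∑ i, (g i).numVars) → RTree A),
    (t.subst g).subst (fun j => h (Fin.cast (numVars_subst t g) j)) =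
      t.subst (fun i => (g i).subst (fun j => h (finSigmaFinEquiv ⟨i, j⟩)))
  | var, g, h => by
    refine congrArg (g ⟨0, Nat.one_pos⟩).subst (funext fun j => congrArg h (Fin.ext ?_))
    refine Eq.trans ?_ (sigma_val (fun i : Fin 1 => (g i).numVars) 0 j).symm
    simp
  | node a ts, g, h => by
    refine congrArg (node a) (funext fun i => ?_)
    let m : (i : Fin _) → Fin (ts i).numVars → ℕ := fun i l => (g (finSigmaFinEquiv ⟨i, l⟩)).numVars
    have e : ∑ i, ∑ l, m i l = ∑ p, (g p).numVars := (sum_sigma_fin (fun p => (g p).numVars)).symm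
    have key := subst_subst (ts i) (fun j => g (finSigmaFinEquiv ⟨i, j⟩))
      (fun q => h (Fin.cast e (finSigmaFinEquiv (n := fun i => ∑ l, m i l) ⟨i, q⟩)))
    refine Eq.trans ?_ (key.trans ?_)
    · refine congrArg (RTree.subst _) (funext fun l => congrArg h (Fin.ext ?_))
      refine (sigma_val (fun i => ((ts i).subst
        (fun j => g (finSigmaFinEquiv ⟨i, j⟩))).numVars) i l).trans ?_
      refine Eq.trans ?_ (sigma_val (fun i => ∑ l, m i l) i _).symm
      simp only [numVars_subst]
      rfl
    · refine congrArg (RTree.subst _) (funext fun l =>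
        congrArg (RTree.subst _) (funext fun r => congrArg h (Fin.ext ?_)))
      refine (sigma_val (fun i => ∑ l, m i l) i _).trans ?_
      refine (congrArg _ (sigma_val (fun l => m i l) l r)).trans ?_
      refine Eq.trans ?_ (sigma_val (fun p => (g p).numVars) (finSigmaFinEquiv ⟨i, l⟩) r).symm
      refine Eq.trans ?_ (congrArg (· + (r : ℕ))
        (sum_Iio_sigma (fun p => (g p).numVars) i l)).symm
      exact (Nat.add_assoc _ _ _).symm

/-- The trees over `A` form a preclone, the free preclone generated by `A`. -/
instance : Preclone (RTree A) where
  rank := numVars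
  one := var
  comp := subst
  rank_one := rfl
  rank_comp := numVars_subst
  one_comp _ := rfl
  comp_one := subst_var
  comp_assoc := subst_subst

/-- The letter `a` of rank `n`, viewed as the tree `a(v_1, …, v_n)`. -/
def letter {n : ℕ} (a : A n) : RTree A := node a (fun _ => var)

/-- The subtree rooted at an address, if the address belongs to the tree. An address is the list
of the directions followed from the root, the children of a node being numbered from `0`. -/
def subtree : RTree A → List ℕ → Option (RTree A)
  | t, [] => some t
  | var, _ :: _ => none
  | node (n := n) _ ts, i :: p => if h : i < n then (ts ⟨i, h⟩).subtree p else none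

/-- The letter (with its rank) at an address, if there is one. -/
def labelAt (t : RTree A) (p : List ℕ) : Option (Σ n, A n) :=
  match t.subtree p with
  | some (node a _) => some ⟨_, a⟩
  | _ => none

/-- The nodes that are labeled by a letter (not by a variable). -/
def NV (t : RTree A) : Set (List ℕ) := {p | ∃ l, t.labelAt p = some l}

/-- The number of variable leaves to the left of (the subtree rooted at) an address. -/
def varsBefore : RTree A → List ℕ → ℕ
  | _, [] => 0
  | var, _ :: _ => 0
  | node (n := n) _ ts, i :: p =>
    if h : i < n then
      ∑ j ∈ Finset.Iio (⟨i, h⟩ : Fin n), (ts j).numVars + (ts ⟨i, h⟩).varsBefore p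
    else 0

/-- The underlying tree structure. -/
def shape : RTree A → RTree (fun _ => Unit)
  | var => var
  | node _ ts => node () (fun i => (ts i).shape)

/-- `t = r · (𝐤₁ ⊕ s ⊕ 𝐤₂)`, where `s` is the subtree of `t` rooted at the address `p`, and `p` is
the address in `r` of the variable that is replaced by `s`. -/
def FactorsAt (t : RTree A) (p : List ℕ) (k₁ k₂ : ℕ) (r s : RTree A) : Prop :=
  t.subtree p = some s ∧ r.subtree p = some var ∧ r.varsBefore p = k₁ ∧
    rank r = k₁ + 1 + k₂ ∧ t = plug r k₁ s

end RTree

/-- The subsets of `Γ M_k`, the set of trees of rank `k` over the ranked alphabet `Γ`. -/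
abbrev TreeLanguage (Γ : RankedAlphabet) (k : ℕ) : Type :=
  Set {t : RTree Γ.Letter // rank t = k}

/-- The tree language `L` over `Γ` is recognized by the pg-pair `(S, A)`: it is the inverse image
of a subset of `S` under a morphism from `Γ M` to `S` that maps all letters into `A`. -/
def PGPair.Recognizes (P : PGPair.{u}) {Γ : RankedAlphabet} {k : ℕ} (L : TreeLanguage Γ k) :
    Prop :=
  ∃ φ : RTree Γ.Letter → P.Carrier, IsMorphism φ ∧
    (∀ (n : ℕ) (a : Γ.Letter n), φ (RTree.letter a) ∈ P.gens) ∧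
    ∃ R : Set P.Carrier, ∀ t, t ∈ L ↔ φ t.1 ∈ R

/-- Recognizable tree languages. -/
def Recognizable {Γ : RankedAlphabet} {k : ℕ} (L : TreeLanguage Γ k) : Prop :=
  ∃ (S : Type) (_ : Preclone S), Preclone.Finitary S ∧
    ∃ φ : RTree Γ.Letter → S, IsMorphism φ ∧ ∃ R : Set S, ∀ t, t ∈ L ↔ φ t.1 ∈ R

/-- Classes of tree languages. -/
abbrev LanguageClass : Type 1 := ∀ (Γ : RankedAlphabet) (k : ℕ), Set (TreeLanguage Γ k)

/-! ### The logic -/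

/-- Formulas of rank `k` over `Γ` whose free variables are among `x_0, …, x_{m-1}`. In
`quant Δ K φ`, that is `Q_K x · ⟨φ_δ⟩_{δ ∈ Δ}`, the bound variable `x` is the last variable `x_m`
of the formulas `φ_δ`. All indices start from `0`: `succ i x y` and `max i j x` are about the child
number `i` (an atom with `i` too large for `Γ` is always false), and `max i j x`, `left j x`,
`right j x` about the variable leaf number `j`. -/
inductive LForm (Γ : RankedAlphabet) (k : ℕ) : ℕ → Type 1
  | tt {m : ℕ} : LForm Γ k m
  | ff {m : ℕ} : LForm Γ k m
  | letter {m n : ℕ} (a : Γ.Letter n) (x : Fin m) : LForm Γ k m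
  | lt {m : ℕ} (x y : Fin m) : LForm Γ k m
  | succ {m : ℕ} (i : ℕ) (x y : Fin m) : LForm Γ k m
  | root {m : ℕ} (x : Fin m) : LForm Γ k m
  | max {m : ℕ} (i : ℕ) (j : Fin k) (x : Fin m) : LForm Γ k m
  | left {m : ℕ} (j : Fin k) (x : Fin m) : LForm Γ k m
  | right {m : ℕ} (j : Fin k) (x : Fin m) : LForm Γ k m
  | not {m : ℕ} (φ : LForm Γ k m) : LForm Γ k m
  | and {m : ℕ} (φ ψ : LForm Γ k m) : LForm Γ k m
  | or {m : ℕ} (φ ψ : LForm Γ k m) : LForm Γ k m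
  | quant {m : ℕ} (Δ : RankedAlphabet) (K : TreeLanguage Δ k)
      (φ : ∀ n, Δ.Letter n → LForm Γ k (m + 1)) : LForm Γ k m

namespace LForm

variable {Γ : RankedAlphabet} {k : ℕ}

/-- Satisfaction of a formula in a tree `t` of rank `k` under the interpretation `ν` of the
variables by nodes of `t`. In the last case `s` is the characteristic tree: it has the same
underlying tree structure as `t`, and each of its nodes `p` is labeled by a letter `δ` such that
`φ_δ` holds when the bound variable is interpreted as `p`. -/
def Sat (t : RTree Γ.Letter) : {m : ℕ} → LForm Γ k m → (Fin m → List ℕ) → Prop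
  | _, tt, _ => True
  | _, ff, _ => False
  | _, letter a x, ν => t.labelAt (ν x) = some ⟨_, a⟩
  | _, lt x y, ν => ν x <+: ν y ∧ ν x ≠ ν y
  | _, succ i x y, ν => ν y = ν x ++ [i]
  | _, root x, ν => ν x = []
  | _, max i j x, ν => t.subtree (ν x ++ [i]) = some .var ∧ t.varsBefore (ν x ++ [i]) = j
  | _, left j x, ν => t.varsBefore (ν x) = j + 1
  | _, right j x, ν => ∃ s, t.subtree (ν x) = some s ∧ t.varsBefore (ν x) + rank s = j
  | _, not φ, ν => ¬ Sat t φ ν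
  | _, and φ ψ, ν => Sat t φ ν ∧ Sat t ψ ν
  | _, or φ ψ, ν => Sat t φ ν ∨ Sat t ψ ν
  | _, quant Δ K φ, ν => ∃ s ∈ K, s.1.shape = t.shape ∧
      ∀ p n (δ : Δ.Letter n), s.1.labelAt p = some ⟨n, δ⟩ → Sat t (φ n δ) (Fin.snoc ν p)

/-- The family `⟨φ_δ⟩_{δ ∈ Δ}` is deterministic with respect to the last variable: for each tree
`t ∈ Γ M_k` and each interpretation mapping this variable to a node of rank `n`, exactly one of the
`φ_δ` with `δ ∈ Δ_n` is satisfied. -/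
def Deterministic {m : ℕ} (Δ : RankedAlphabet) (φ : ∀ n, Δ.Letter n → LForm Γ k (m + 1)) : Prop :=
  ∀ t : RTree Γ.Letter, rank t = k → ∀ ν : Fin m → List ℕ, (∀ x, ν x ∈ t.NV) →
    ∀ (p : List ℕ) (n : ℕ) (a : Γ.Letter n), t.labelAt p = some ⟨n, a⟩ →
      ∃! δ : Δ.Letter n, Sat t (φ n δ) (Fin.snoc ν p)

/-- The formulas of the fragment `𝐋𝐢𝐧𝐝(𝒦)`: each quantifier is of the form `Q_K` with `K ∈ 𝒦` a
language over an alphabet `Δ` such that `Δ_n` is non-empty whenever `Γ_n` is, and is applied to a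
deterministic family. -/
def InLind (𝒦 : LanguageClass) : {m : ℕ} → LForm Γ k m → Prop
  | _, not φ => InLind 𝒦 φ
  | _, and φ ψ => InLind 𝒦 φ ∧ InLind 𝒦 ψ
  | _, or φ ψ => InLind 𝒦 φ ∧ InLind 𝒦 ψ
  | _, quant Δ K φ => K ∈ 𝒦 Δ k ∧ (∀ n, Nonempty (Γ.Letter n) → Nonempty (Δ.Letter n)) ∧
      Deterministic Δ φ ∧ ∀ n δ, InLind 𝒦 (φ n δ)
  | _, _ => True

/-- `t ⊨ φ` for a sentence `φ`. -/
def Models (t : RTree Γ.Letter) (φ : LForm Γ k 0) : Prop := Sat t φ Fin.elim0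

end LForm

open LForm

/-- The class of `𝐋𝐢𝐧𝐝(𝒦)`-definable tree languages. Formulas are not interpreted on the tree `𝟏`
without letters, so tree languages are compared with the sets `L_φ` on the other trees only. -/
def LindClass (𝒦 : LanguageClass) : LanguageClass := fun Γ k =>
  {L | ∃ φ : LForm Γ k 0, InLind 𝒦 φ ∧ ∀ t, t.1 ≠ RTree.var → (t ∈ L ↔ Models t.1 φ)}

/-- Property `R1` of relativization. The case `r = 𝟏`, where `r ⊨ φ` has no meaning, is
excluded. -/
def RelativizesAbove (𝒦 : LanguageClass) : Prop :=
  ∀ (Γ : RankedAlphabet) (k₁ k₂ k : ℕ), k₁ + k₂ ≤ k →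
    ∀ φ : LForm Γ (k₁ + 1 + k₂) 0, InLind 𝒦 φ → ∃ ψ : LForm Γ k 1, InLind 𝒦 ψ ∧
      ∀ t : RTree Γ.Letter, rank t = k → ∀ p ∈ t.NV, (∀ s, ¬ t.FactorsAt p k₁ k₂ .var s) →
        (Sat t ψ (fun _ => p) ↔ ∃ r s, t.FactorsAt p k₁ k₂ r s ∧ Models r φ)

/-- Property `R2` of relativization; `i` is the number of the child, counting from `0`. The case
`s = 𝟏`, where `s ⊨ φ` has no meaning, is excluded. -/
def RelativizesBelow (𝒦 : LanguageClass) : Prop :=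
  ∀ (Γ : RankedAlphabet) (i : ℕ), (∃ n, i < n ∧ Nonempty (Γ.Letter n)) → ∀ k₁ k₂ l : ℕ,
    ∀ φ : LForm Γ l 0, InLind 𝒦 φ → ∃ ψ : LForm Γ (k₁ + l + k₂) 1, InLind 𝒦 ψ ∧
      ∀ t : RTree Γ.Letter, rank t = k₁ + l + k₂ → ∀ p ∈ t.NV,
        (∀ r, ¬ t.FactorsAt (p ++ [i]) k₁ k₂ r .var) →
        (Sat t ψ (fun _ => p) ↔
          ∃ r s, t.FactorsAt (p ++ [i]) k₁ k₂ r s ∧ rank s = l ∧ Models s φ)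

/-- The logic `𝐋𝐢𝐧𝐝(𝒦)` admits relativization. -/
def AdmitsRelativization (𝒦 : LanguageClass) : Prop :=
  RelativizesAbove 𝒦 ∧ RelativizesBelow 𝒦

/-!
Let `φ` be a morphism from `Γ M` to the block product of `(S, A)` and `(T, B)` that maps letters to
generators, and let `τ` be its second component. An element of rank `n` of the block product is
determined by its second component and by the values of its first component at the finitely many
`n`-ary contexts in `T_k` (`BlockProduct.ext_eval`), so a language recognized by `φ` is a Boolean
combination of languages `{t | τ t = d}` and `{t | (φ t)_1(C) = s}`. The former are recognized by
`(T, B)`; the latter are the point.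

Unfolding the composition of the block product along a tree `t` shows that `(φ t)_1(C)` is the value
in `S` of the tree over the alphabet `A` in which each node `p` carries the generator
`(φ σ)_1(C_p)`, where `σ` is the letter of `t` at `p` and `C_p` is the context that `C` induces at
`p` (`BlockProduct.lift_relabel`). The trees over `A` with a given value in `S` form a language
recognized by `(S, A)`, which is therefore definable. Replacing the atoms `P_δ(x)` of a defining
sentence by formulas `θ_δ(x)` saying that the letter at `x` is to be replaced by `δ` yields a
sentence for `{t | (φ t)_1(C) = s}` (`LForm.Definable.relabel`). Such a substitution takes
deterministic families to deterministic families, so that one remains in the fragment.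

It remains to define `θ_δ`. The context `C_p` depends only on the number of variables to the left of
`p`, the value under `τ` of `t` without the subtree at `p`, and the values under `τ` of the subtrees
at the children of `p` (`SeqContext.atNode`). All these data range over finite sets. Their
definability is what relativization gives (`LForm.definable_above`, `LForm.definable_below`); the
cases in which a factor is the tree `𝟏`, which relativization does not cover, are expressed by the
atoms `root` and `max`.

Contexts and tuples are handled through sequences indexed by all natural numbers
(`SeqContext`), which avoids transports along equalities of ranks.
-/

/-! ### Compositions with tuples indexed by the natural numbers -/

namespace Preclone

section naturalIndex

variable {S : Type u} [Preclone S]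

lemma sum_Iio_eq_sum_range {n : ℕ} (F : ℕ → ℕ) (i : Fin n) :
    ∑ j ∈ Finset.Iio i, F j = ∑ j ∈ Finset.range i, F j := by
  rw [sum_Iio_eq]
  exact Fin.sum_univ_eq_sum_range F i

/-- Associativity: the `j`-th variable of the `i`-th component of `g` is the variable number
`∑ l < i, rank (g l) + j` of the composition. -/
lemma comp_comp_nat (f : S) (g : ℕ → S) (w : ℕ → S) :
    comp (comp f (fun i => g i)) (fun i => w i) =
      comp f (fun i => comp (g i) (fun j => w (∑ l ∈ Finset.range i, rank (g l) + j))) := by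
  rw [comp_assoc']
  refine comp_congr rfl _ _ fun i => comp_congr rfl _ _ fun j => ?_
  rw [Fin.val_cast, sigma_val (fun i : Fin (rank f) => rank (g i)) i j,
    sum_Iio_eq_sum_range (fun l => rank (g l)) i]
  rfl

lemma comp_congr_nat {f f' : S} {w w' : ℕ → S} (hf : f = f') (h : ∀ i < rank f, w i = w' i) :
    comp f (fun i => w i) = comp f' (fun i => w' i) :=
  comp_congr hf _ _ fun i => h i i.2

lemma rank_comp_nat (f : S) (w : ℕ → S) :
    rank (comp f (fun i => w i)) = ∑ i ∈ Finset.range (rank f), rank (w i) := by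
  rw [rank_comp]
  exact Fin.sum_univ_eq_sum_range (fun i => rank (w i)) _

lemma one_comp_nat (w : ℕ → S) : comp one (fun i => w i) = w 0 := by
  refine (comp_congr (g' := fun _ => w 0) rfl _ fun i => ?_).trans (one_comp (w 0))
  have h := lt_of_lt_of_eq i.2 rank_one
  exact congrArg w (by omega)

lemma sum_range_update {n i : ℕ} (hi : i < n) (F : ℕ → ℕ) (y : ℕ) :
    ∑ j ∈ Finset.range n, (if j = i then y else F j) + F i = ∑ j ∈ Finset.range n, F j + y := by
  have hi' : i ∈ Finset.range n := Finset.mem_range.2 hi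
  have e : ∑ j ∈ (Finset.range n).erase i, (if j = i then y else F j) =
      ∑ j ∈ (Finset.range n).erase i, F j :=
    Finset.sum_congr rfl fun j hj => if_neg (Finset.ne_of_mem_erase hj)
  rw [← Finset.add_sum_erase _ F hi', ← Finset.add_sum_erase _ _ hi', if_pos rfl, e]
  ring

lemma sum_range_le {n i : ℕ} (hi : i < n) (F : ℕ → ℕ) :
    ∑ j ∈ Finset.range i, F j + F i ≤ ∑ j ∈ Finset.range n, F j := by
  rw [← Finset.sum_range_succ]
  exact Finset.sum_le_sum_of_subset (Finset.range_mono hi)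

/-- Plugging into a component of a composition that is the unit. -/
lemma plug_comp_update (f : S) (w : ℕ → S) {i : ℕ} (hi : i < rank f) (y : S) :
    plug (comp f (fun j => if (j : ℕ) = i then one else w j))
      (∑ j ∈ Finset.range i, rank (w j)) y = comp f (fun j => if (j : ℕ) = i then y else w j) := by
  rw [plug_comp_one f _ ⟨i, hi⟩ y]
  · refine comp_congr rfl _ _ fun j => ?_
    simp only [Fin.ext_iff, Fin.val_cast]
    split_ifs <;> rfl
  · rw [sum_Iio_eq_sum_range (fun j => rank (if j = i then one else w j)) ⟨i, hi⟩]
    refine Finset.sum_congr rfl fun j hj => ?_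
    rw [if_neg (Finset.mem_range.1 hj).ne]
  · exact if_pos rfl

lemma plug_unit (u : S) (p : ℕ) : plug u p one = u := by
  conv_rhs => rw [← comp_one u]
  unfold plug
  simp only [ite_self]

end naturalIndex

end Preclone

/-! ### Trees: addresses, replacement, relabeling, evaluation -/

namespace RTree

variable {A B : ℕ → Type}

/-- The `i`-th tree of a tuple, and the tree `𝟏` if `i` is too large. -/
def kid {n : ℕ} (ts : Fin n → RTree A) (i : ℕ) : RTree A :=
  if h : i < n then ts ⟨i, h⟩ else var

lemma kid_of_lt {n : ℕ} (ts : Fin n → RTree A) {i : ℕ} (h : i < n) : kid ts i = ts ⟨i, h⟩ :=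
  dif_pos h

@[simp] lemma kid_val {n : ℕ} (ts : Fin n → RTree A) (i : Fin n) : kid ts i = ts i :=
  dif_pos i.2

lemma numVars_node {n : ℕ} (a : A n) (ts : Fin n → RTree A) :
    (node a ts).numVars = ∑ i ∈ Finset.range n, (kid ts i).numVars := by
  rw [← Fin.sum_univ_eq_sum_range (fun i => (kid ts i).numVars)]
  simp [numVars]

lemma rank_letter {n : ℕ} (a : A n) : rank (letter a) = n := by
  change ∑ i : Fin n, 1 = n
  simp

lemma node_eq_comp {n : ℕ} (a : A n) (ts : Fin n → RTree A) :
    node a ts = comp (letter a) (fun i => kid ts i) := by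
  refine congrArg (node a) (funext fun i => ?_)
  refine ((congrArg (kid ts) ((sigma_val (fun _ : Fin n => 1) i 0).trans ?_)).trans
    (kid_val ts i)).symm
  simp

/-- The value of a morphism on a tree with root letter `a`. -/
lemma map_node {S : Type u} [Preclone S] {φ : RTree A → S} (hφ : IsMorphism φ) {n : ℕ} (a : A n)
    (ts : Fin n → RTree A) : φ (node a ts) = comp (φ (letter a)) (fun i => φ (kid ts i)) := by
  rw [node_eq_comp, hφ.map_comp]
  rfl

section addresses

lemma subtree_nil (t : RTree A) : t.subtree [] = some t := by cases t <;> rfl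

lemma subtree_node_cons {n : ℕ} (a : A n) (ts : Fin n → RTree A) {i : ℕ} (h : i < n)
    (p : List ℕ) : (node a ts).subtree (i :: p) = (kid ts i).subtree p := by
  rw [kid_of_lt ts h]
  exact dif_pos h

lemma subtree_node_cons_of_ge {n : ℕ} (a : A n) (ts : Fin n → RTree A) {i : ℕ} (h : ¬ i < n)
    (p : List ℕ) : (node a ts).subtree (i :: p) = none := dif_neg h

lemma varsBefore_nil (t : RTree A) : t.varsBefore [] = 0 := by cases t <;> rfl

lemma varsBefore_node_cons {n : ℕ} (a : A n) (ts : Fin n → RTree A) {i : ℕ} (h : i < n)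
    (p : List ℕ) : (node a ts).varsBefore (i :: p) =
      ∑ j ∈ Finset.range i, (kid ts j).numVars + (kid ts i).varsBefore p := by
  rw [kid_of_lt ts h, ← sum_Iio_eq_sum_range (fun j => (kid ts j).numVars) ⟨i, h⟩]
  simp [varsBefore, h]

lemma labelAt_var (p : List ℕ) : (var : RTree A).labelAt p = none := by cases p <;> rfl

lemma labelAt_node_nil {n : ℕ} (a : A n) (ts : Fin n → RTree A) :
    (node a ts).labelAt [] = some ⟨n, a⟩ := rfl

lemma labelAt_node_cons {n : ℕ} (a : A n) (ts : Fin n → RTree A) {i : ℕ} (h : i < n)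
    (p : List ℕ) : (node a ts).labelAt (i :: p) = (kid ts i).labelAt p := by
  unfold labelAt
  rw [subtree_node_cons a ts h]

lemma labelAt_node_cons_of_ge {n : ℕ} (a : A n) (ts : Fin n → RTree A) {i : ℕ} (h : ¬ i < n)
    (p : List ℕ) : (node a ts).labelAt (i :: p) = none := by
  unfold labelAt
  rw [subtree_node_cons_of_ge a ts h]

lemma labelAt_eq_some {t : RTree A} {p : List ℕ} {n : ℕ} {a : A n}
    (h : t.labelAt p = some ⟨n, a⟩) : ∃ ts, t.subtree p = some (node a ts) := by
  unfold labelAt at h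
  split at h
  · rename_i m b ts hs
    rw [Option.some_inj, Sigma.mk.injEq] at h
    obtain ⟨rfl, h⟩ := h
    obtain rfl := eq_of_heq h
    exact ⟨ts, hs⟩
  · cases h

lemma subtree_append {t s : RTree A} {p : List ℕ} (h : t.subtree p = some s) (q : List ℕ) :
    t.subtree (p ++ q) = s.subtree q := by
  induction p generalizing t with
  | nil =>
    rw [subtree_nil] at h
    cases h
    rfl
  | cons i p ih =>
    cases t with
    | var => cases h
    | @node n a ts =>
      by_cases hi : i < n
      · rw [subtree_node_cons a ts hi] at h
        rw [List.cons_append, subtree_node_cons a ts hi, ih h]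
      · rw [subtree_node_cons_of_ge a ts hi] at h
        cases h

lemma varsBefore_add_le {t s : RTree A} {p : List ℕ} (h : t.subtree p = some s) :
    t.varsBefore p + s.numVars ≤ t.numVars := by
  induction p generalizing t with
  | nil =>
    rw [subtree_nil] at h
    cases h
    rw [varsBefore_nil, Nat.zero_add]
  | cons i p ih =>
    cases t with
    | var => cases h
    | @node n a ts =>
      by_cases hi : i < n
      · rw [subtree_node_cons a ts hi] at h
        rw [varsBefore_node_cons a ts hi, numVars_node]
        have := ih h
        have := sum_range_le hi (fun j => (kid ts j).numVars)
        omega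
      · rw [subtree_node_cons_of_ge a ts hi] at h
        cases h

end addresses

section replaceAt

/-- The tree obtained by replacing the subtree rooted at an address; the tree is left unchanged if
the address does not belong to it. -/
def replaceAt : RTree A → List ℕ → RTree A → RTree A
  | _, [], s => s
  | var, _ :: _, _ => var
  | node a ts, i :: p, s => node a (fun j => if (j : ℕ) = i then (ts j).replaceAt p s else ts j)

lemma replaceAt_nil (t s : RTree A) : t.replaceAt [] s = s := by cases t <;> rfl

lemma kid_replaceAt {n : ℕ} (ts : Fin n → RTree A) {i : ℕ} (hi : i < n) (p : List ℕ)
    (s : RTree A) (j : ℕ) :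
    kid (fun j : Fin n => if (j : ℕ) = i then (ts j).replaceAt p s else ts j) j =
      if j = i then (kid ts i).replaceAt p s else kid ts j := by
  by_cases hj : j < n
  · rw [kid_of_lt _ hj, kid_of_lt ts hj]
    split_ifs with h
    · subst h
      rw [kid_of_lt ts hj]
    · rfl
  · rw [if_neg (by omega), kid, kid, dif_neg hj, dif_neg hj]

lemma subtree_replaceAt {t x : RTree A} {p : List ℕ} (h : t.subtree p = some x) (s : RTree A) :
    (t.replaceAt p s).subtree p = some s := by
  induction p generalizing t with
  | nil => rw [replaceAt_nil, subtree_nil]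
  | cons i p ih =>
    cases t with
    | var => cases h
    | @node n a ts =>
      by_cases hi : i < n
      · rw [subtree_node_cons a ts hi] at h
        rw [replaceAt, subtree_node_cons _ _ hi, kid_replaceAt ts hi, if_pos rfl, ih h]
      · rw [subtree_node_cons_of_ge a ts hi] at h
        cases h

lemma varsBefore_replaceAt {t x : RTree A} {p : List ℕ} (h : t.subtree p = some x)
    (s : RTree A) : (t.replaceAt p s).varsBefore p = t.varsBefore p := by
  induction p generalizing t with
  | nil => rw [varsBefore_nil, varsBefore_nil]
  | cons i p ih =>
    cases t with
    | var => cases h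
    | @node n a ts =>
      by_cases hi : i < n
      · rw [subtree_node_cons a ts hi] at h
        rw [replaceAt, varsBefore_node_cons _ _ hi, varsBefore_node_cons _ _ hi,
          kid_replaceAt ts hi, if_pos rfl, ih h]
        congr 1
        refine Finset.sum_congr rfl fun j hj => ?_
        rw [kid_replaceAt ts hi, if_neg (Finset.mem_range.1 hj).ne]
      · rw [subtree_node_cons_of_ge a ts hi] at h
        cases h

lemma replaceAt_replaceAt {t : RTree A} (p : List ℕ) (s s' : RTree A) :
    (t.replaceAt p s).replaceAt p s' = t.replaceAt p s' := by
  induction p generalizing t with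
  | nil => rw [replaceAt_nil, replaceAt_nil]
  | cons i p ih =>
    cases t with
    | var => rfl
    | @node n a ts =>
      refine congrArg (node a) (funext fun j => ?_)
      by_cases h : (j : ℕ) = i
      · simp only [if_pos h, ih]
      · simp only [if_neg h]

lemma replaceAt_subtree {t s : RTree A} {p : List ℕ} (h : t.subtree p = some s) :
    t.replaceAt p s = t := by
  induction p generalizing t with
  | nil =>
    rw [subtree_nil] at h
    cases h
    rw [replaceAt_nil]
  | cons i p ih =>
    cases t with
    | var => cases h
    | @node n a ts =>
      by_cases hi : i < n
      · rw [subtree_node_cons a ts hi] at h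
        refine congrArg (node a) (funext fun j => ?_)
        split_ifs with hj
        · subst hj
          rw [kid_val] at h
          exact ih h
        · rfl
      · rw [subtree_node_cons_of_ge a ts hi] at h
        cases h

lemma numVars_replaceAt {t x : RTree A} {p : List ℕ} (h : t.subtree p = some x) (s : RTree A) :
    (t.replaceAt p s).numVars + x.numVars = t.numVars + s.numVars := by
  induction p generalizing t with
  | nil =>
    rw [subtree_nil] at h
    cases h
    rw [replaceAt_nil, Nat.add_comm]
  | cons i p ih =>
    cases t with
    | var => cases h
    | @node n a ts =>
      by_cases hi : i < n
      · rw [subtree_node_cons a ts hi] at h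
        rw [replaceAt, numVars_node, numVars_node]
        have e := ih h
        have e' := sum_range_update hi (fun j => (kid ts j).numVars)
          ((kid ts i).replaceAt p s).numVars
        simp only [kid_replaceAt ts hi, apply_ite numVars]
        omega
      · rw [subtree_node_cons_of_ge a ts hi] at h
        cases h

/-- Attaching a tree at a variable leaf is the same as replacing that leaf. -/
lemma plug_eq_replaceAt {r : RTree A} {p : List ℕ} (h : r.subtree p = some var) (s : RTree A) :
    plug r (r.varsBefore p) s = r.replaceAt p s := by
  induction p generalizing r with
  | nil =>
    rw [subtree_nil] at h
    cases h
    exact plug_one s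
  | cons i p ih =>
    cases r with
    | var => cases h
    | @node n a ts =>
      by_cases hi : i < n
      · rw [subtree_node_cons a ts hi] at h
        have hi' : i < rank (letter a) := by rwa [rank_letter]
        rw [replaceAt, node_eq_comp, node_eq_comp]
        have hq := varsBefore_add_le h
        rw [plug_comp (letter a) (fun j => kid ts j) ⟨i, hi'⟩ ⟨(kid ts i).varsBefore p, hq⟩,
          ih h]
        · refine comp_congr rfl _ _ fun j => ?_
          rw [kid_replaceAt ts hi]
          simp only [Fin.ext_iff]
          rfl
        · rw [← node_eq_comp, varsBefore_node_cons a ts hi,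
            sum_Iio_eq_sum_range (fun l => rank (kid ts l)) ⟨i, hi'⟩]
          rfl
      · rw [subtree_node_cons_of_ge a ts hi] at h
        cases h

/-- The factorization of a tree at an address is unique: the upper factor is obtained by replacing
the subtree by a variable. -/
lemma factorsAt_iff {t r s : RTree A} {p : List ℕ} {k₁ k₂ : ℕ} :
    t.FactorsAt p k₁ k₂ r s ↔ t.subtree p = some s ∧ r = t.replaceAt p var ∧
      t.varsBefore p = k₁ ∧ k₁ + s.numVars + k₂ = t.numVars := by
  constructor
  · rintro ⟨h, hr, rfl, hk, ht⟩
    rw [plug_eq_replaceAt hr] at ht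
    have e : r = t.replaceAt p var := by rw [ht, replaceAt_replaceAt, replaceAt_subtree hr]
    refine ⟨h, e, by rw [ht, varsBefore_replaceAt hr], ?_⟩
    have h1 := numVars_replaceAt h var
    rw [← e] at h1
    change r.numVars + s.numVars = t.numVars + 1 at h1
    change r.numVars = _ at hk
    omega
  · rintro ⟨h, rfl, rfl, hk⟩
    refine ⟨h, subtree_replaceAt h _, varsBefore_replaceAt h _, ?_, ?_⟩
    · have h1 := numVars_replaceAt h var
      change _ = t.numVars + 1 at h1
      change (t.replaceAt p var).numVars = _
      omega
    · conv_rhs => rw [← varsBefore_replaceAt h var]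
      rw [plug_eq_replaceAt (subtree_replaceAt h _), replaceAt_replaceAt, replaceAt_subtree h]

lemma replaceAt_eq_var {t x : RTree A} {p : List ℕ} (h : t.subtree p = some x)
    (e : t.replaceAt p var = var) : p = [] := by
  cases p with
  | nil => rfl
  | cons i p =>
    cases t with
    | var => cases h
    | node a ts => cases e

end replaceAt

section shape

lemma kid_shape {n : ℕ} (ts : Fin n → RTree A) (i : ℕ) :
    kid (fun j => (ts j).shape) i = (kid ts i).shape := by
  unfold kid
  split_ifs <;> rfl

lemma numVars_shape : ∀ t : RTree A, t.shape.numVars = t.numVars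
  | var => rfl
  | node _ ts => Finset.sum_congr rfl fun i _ => numVars_shape (ts i)

lemma subtree_shape (t : RTree A) (p : List ℕ) :
    t.shape.subtree p = (t.subtree p).map shape := by
  induction p generalizing t with
  | nil => rw [subtree_nil, subtree_nil]; rfl
  | cons i p ih =>
    cases t with
    | var => rfl
    | @node n a ts =>
      by_cases hi : i < n
      · rw [shape, subtree_node_cons _ _ hi, subtree_node_cons _ _ hi, kid_shape, ih]
      · rw [shape, subtree_node_cons_of_ge _ _ hi, subtree_node_cons_of_ge _ _ hi]
        rfl

lemma varsBefore_shape (t : RTree A) (p : List ℕ) : t.shape.varsBefore p = t.varsBefore p := by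
  induction p generalizing t with
  | nil => rw [varsBefore_nil, varsBefore_nil]
  | cons i p ih =>
    cases t with
    | var => rfl
    | @node n a ts =>
      by_cases hi : i < n
      · rw [shape, varsBefore_node_cons _ _ hi, varsBefore_node_cons _ _ hi, kid_shape, ih]
        simp only [kid_shape, numVars_shape]
      · simp [shape, varsBefore, hi]

lemma shape_eq_var {t : RTree A} : t.shape = var ↔ t = var := by
  cases t with
  | var => simp [shape]
  | node a ts => simp [shape]

lemma labelAt_shape (t : RTree A) (p : List ℕ) :
    t.shape.labelAt p = (t.labelAt p).map (fun l => ⟨l.1, ()⟩) := by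
  unfold labelAt
  rw [subtree_shape]
  cases t.subtree p with
  | none => rfl
  | some s => cases s <;> rfl

variable {s : RTree B} {t : RTree A}

lemma numVars_eq_of_shape_eq (h : s.shape = t.shape) : s.numVars = t.numVars := by
  rw [← numVars_shape, h, numVars_shape]

lemma varsBefore_eq_of_shape_eq (h : s.shape = t.shape) (p : List ℕ) :
    s.varsBefore p = t.varsBefore p := by
  rw [← varsBefore_shape, h, varsBefore_shape]

lemma subtree_var_of_shape_eq (h : s.shape = t.shape) (p : List ℕ) :
    s.subtree p = some var ↔ t.subtree p = some var := by
  have aux : ∀ {C : ℕ → Type} (x : RTree C),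
      x.subtree p = some var ↔ x.shape.subtree p = some var := by
    intro C x
    rw [subtree_shape]
    cases x.subtree p with
    | none => simp
    | some y => simp [shape_eq_var]
  rw [aux s, aux t, h]

lemma exists_subtree_of_shape_eq (h : s.shape = t.shape) {p : List ℕ} {x : RTree B}
    (hx : s.subtree p = some x) : ∃ y, t.subtree p = some y ∧ y.numVars = x.numVars := by
  have e := subtree_shape s p
  rw [h, subtree_shape, hx] at e
  cases hy : t.subtree p with
  | none => rw [hy] at e; cases e
  | some y =>
    rw [hy, Option.map_some, Option.map_some, Option.some_inj] at e
    exact ⟨y, rfl, numVars_eq_of_shape_eq e⟩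

lemma exists_labelAt_of_shape_eq (h : s.shape = t.shape) {p : List ℕ} {n : ℕ} {b : B n}
    (hb : s.labelAt p = some ⟨n, b⟩) : ∃ a : A n, t.labelAt p = some ⟨n, a⟩ := by
  have e := labelAt_shape s p
  rw [h, labelAt_shape, hb] at e
  cases hy : t.labelAt p with
  | none => rw [hy] at e; cases e
  | some l =>
    rw [hy, Option.map_some, Option.map_some, Option.some_inj, Sigma.mk.injEq] at e
    obtain ⟨m, a⟩ := l
    obtain ⟨rfl, -⟩ := e
    exact ⟨a, rfl⟩

lemma NV_eq_of_shape_eq (h : s.shape = t.shape) : s.NV = t.NV := by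
  ext p
  constructor
  · rintro ⟨⟨n, b⟩, hb⟩
    obtain ⟨a, ha⟩ := exists_labelAt_of_shape_eq h hb
    exact ⟨_, ha⟩
  · rintro ⟨⟨n, a⟩, ha⟩
    obtain ⟨b, hb⟩ := exists_labelAt_of_shape_eq h.symm ha
    exact ⟨_, hb⟩

end shape

section relabel

/-- Relabeling of the nodes, the new letter depending on the address and the old letter. -/
def relabel : RTree A → (List ℕ → ∀ n, A n → B n) → RTree B
  | var, _ => var
  | node (n := n) a ts, f => node (f [] n a) (fun i => (ts i).relabel (fun p => f (i :: p)))

lemma shape_relabel : ∀ (t : RTree A) (f : List ℕ → ∀ n, A n → B n),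
    (t.relabel f).shape = t.shape
  | var, _ => rfl
  | node _ ts, _ =>
    congrArg (node (A := fun _ => Unit) ()) (funext fun i => shape_relabel (ts i) _)

lemma kid_relabel {n : ℕ} (ts : Fin n → RTree A) (f : List ℕ → ∀ n, A n → B n) (i : ℕ) :
    kid (fun j => (ts j).relabel (fun p => f (j :: p))) i =
      (kid ts i).relabel (fun p => f (i :: p)) := by
  unfold kid
  split_ifs <;> rfl

lemma labelAt_relabel (t : RTree A) (f : List ℕ → ∀ n, A n → B n) (p : List ℕ) :
    (t.relabel f).labelAt p = (t.labelAt p).map (fun l => ⟨l.1, f p l.1 l.2⟩) := by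
  induction p generalizing t f with
  | nil => cases t <;> rfl
  | cons i p ih =>
    cases t with
    | var => rfl
    | @node n a ts =>
      by_cases hi : i < n
      · rw [relabel, labelAt_node_cons _ _ hi, labelAt_node_cons _ _ hi, kid_relabel, ih]
      · rw [relabel, labelAt_node_cons_of_ge _ _ hi, labelAt_node_cons_of_ge _ _ hi]
        rfl

end relabel

section lift

variable {S : Type u} [Preclone S]

/-- The morphism from the free preclone of trees that extends a rank preserving map of the
letters. -/
def lift (f : ∀ n, A n → S) (hf : ∀ n a, rank (f n a) = n) : RTree A → S
  | var => one
  | node (n := n) a ts => comp (f n a) (fun i => lift f hf (ts (Fin.cast (hf n a) i)))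

variable (f : ∀ n, A n → S) (hf : ∀ n a, rank (f n a) = n)

lemma lift_node {n : ℕ} (a : A n) (ts : Fin n → RTree A) :
    lift f hf (node a ts) = comp (f n a) (fun i => lift f hf (kid ts i)) := by
  refine comp_congr rfl _ _ fun i => ?_
  exact congrArg (lift f hf) (kid_val ts (Fin.cast (hf n a) i)).symm

lemma lift_letter {n : ℕ} (a : A n) : lift f hf (letter a) = f n a := comp_one _

lemma rank_lift : ∀ t : RTree A, rank (lift f hf t) = rank t
  | var => rank_one
  | node (n := n) a ts => by
    refine (rank_comp _ _).trans ?_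
    refine (Finset.sum_congr rfl fun i _ => rank_lift _).trans ?_
    exact Equiv.sum_comp (finCongr (hf n a)) (fun i => rank (ts i))

lemma lift_subst : ∀ (t : RTree A) (w : ℕ → RTree A),
    lift f hf (t.subst (fun i => w i)) = comp (lift f hf t) (fun i => lift f hf (w i))
  | var, w => (one_comp_nat (fun i => lift f hf (w i))).symm
  | node (n := n) a ts, w => by
    have e : (node a ts).subst (fun i => w i) = node a (fun i => (ts i).subst
        (fun j => w (∑ l ∈ Finset.range i, (kid ts l).numVars + j))) := by
      refine congrArg (node a) (funext fun i => congrArg _ (funext fun j => ?_))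
      refine congrArg w ((sigma_val (fun i => (ts i).numVars) i j).trans ?_)
      rw [← sum_Iio_eq_sum_range (fun l => (kid ts l).numVars)]
      simp only [kid_val]
    rw [e, lift_node]
    refine Eq.trans ?_ ((comp_congr (lift_node f hf a ts) _ _ fun i => rfl).trans
      (comp_comp_nat (f n a) (fun i => lift f hf (kid ts i)) (fun i => lift f hf (w i)))).symm
    refine comp_congr rfl _ _ fun i => ?_
    have hi : (i : ℕ) < n := lt_of_lt_of_eq i.2 (hf n a)
    rw [kid_of_lt _ hi]
    have := lift_subst (ts ⟨i, hi⟩)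
      (fun j => w (∑ l ∈ Finset.range i, (kid ts l).numVars + j))
    refine this.trans ?_
    refine comp_congr (by rw [Fin.val_cast, kid_of_lt _ hi]) _ _ fun j => ?_
    simp only [rank_lift]
    rfl

lemma isMorphism_lift : IsMorphism (lift f hf) where
  map_rank := rank_lift f hf
  map_one := rfl
  map_comp t g := by
    let w : ℕ → RTree A := fun i => if h : i < rank t then g ⟨i, h⟩ else var
    have hw : (fun i : Fin (rank t) => w i) = g := funext fun i => dif_pos i.2
    have h := lift_subst f hf t w
    change lift f hf (comp t (fun i => w i)) = _ at h
    rw [hw] at h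
    refine h.trans (comp_congr rfl _ _ fun i => ?_)
    congr 1
    exact dif_pos (lt_of_lt_of_eq i.2 (rank_lift f hf t))

end lift

end RTree

/-! ### Substitution of formulas for letters and definable relations -/

instance RankedAlphabet.finite_letter (Γ : RankedAlphabet) (n : ℕ) : Finite (Γ.Letter n) :=
  have := Γ.finite
  Finite.of_injective (fun a : Γ.Letter n => (⟨n, a⟩ : Σ n, Γ.Letter n)) sigma_mk_injective

namespace LForm

variable {Γ Δ : RankedAlphabet} {k : ℕ} {𝒦 : LanguageClass}

section disjunction

/-- The disjunction of a list of formulas. -/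
def orList {m : ℕ} : List (LForm Γ k m) → LForm Γ k m
  | [] => ff
  | φ :: l => or φ (orList l)

lemma sat_orList {m : ℕ} (t : RTree Γ.Letter) (ν : Fin m → List ℕ) (l : List (LForm Γ k m)) :
    Sat t (orList l) ν ↔ ∃ φ ∈ l, Sat t φ ν := by
  induction l with
  | nil => simp [orList, Sat]
  | cons φ l ih => simp [orList, Sat, ih]

lemma inLind_orList {m : ℕ} (l : List (LForm Γ k m)) (h : ∀ φ ∈ l, InLind 𝒦 φ) :
    InLind 𝒦 (orList l) := by
  induction l with
  | nil => trivial
  | cons φ l ih => exact ⟨h φ (by simp), ih fun ψ hψ => h ψ (by simp [hψ])⟩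

/-- The disjunction of a finite family of formulas. -/
noncomputable def iOr {m : ℕ} {ι : Type*} [Finite ι] (φ : ι → LForm Γ k m) : LForm Γ k m :=
  orList ((Set.finite_range φ).toFinset.toList)

variable {m : ℕ} {ι : Type*} [Finite ι]

lemma sat_iOr (t : RTree Γ.Letter) (ν : Fin m → List ℕ) (φ : ι → LForm Γ k m) :
    Sat t (iOr φ) ν ↔ ∃ i, Sat t (φ i) ν := by
  simp [iOr, sat_orList]

lemma inLind_iOr (φ : ι → LForm Γ k m) (h : ∀ i, InLind 𝒦 (φ i)) : InLind 𝒦 (iOr φ) := by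
  refine inLind_orList _ fun ψ hψ => ?_
  simp only [Finset.mem_toList, Set.Finite.mem_toFinset, Set.mem_range] at hψ
  obtain ⟨i, rfl⟩ := hψ
  exact h i

end disjunction

section rename

/-- The extension of a renaming of variables that fixes the bound variable. -/
def liftVar {m m' : ℕ} (f : Fin m → Fin m') : Fin (m + 1) → Fin (m' + 1) :=
  Fin.snoc (α := fun _ => Fin (m' + 1)) (fun i => (f i).castSucc) (Fin.last m')

lemma snoc_comp_liftVar {m m' : ℕ} (f : Fin m → Fin m') (ν : Fin m' → List ℕ) (p : List ℕ) :
    (fun x => (Fin.snoc ν p : Fin (m' + 1) → List ℕ) (liftVar f x)) =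
      Fin.snoc (fun x => ν (f x)) p := by
  funext x
  refine Fin.lastCases ?_ (fun i => ?_) x
  · simp [liftVar]
  · simp [liftVar]

/-- Renaming of the free variables. -/
def rename : {m m' : ℕ} → LForm Γ k m → (Fin m → Fin m') → LForm Γ k m'
  | _, _, tt, _ => tt
  | _, _, ff, _ => ff
  | _, _, letter a x, f => letter a (f x)
  | _, _, lt x y, f => lt (f x) (f y)
  | _, _, succ i x y, f => succ i (f x) (f y)
  | _, _, root x, f => root (f x)
  | _, _, max i j x, f => max i j (f x)
  | _, _, left j x, f => left j (f x)
  | _, _, right j x, f => right j (f x)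
  | _, _, not φ, f => not (φ.rename f)
  | _, _, and φ ψ, f => and (φ.rename f) (ψ.rename f)
  | _, _, or φ ψ, f => or (φ.rename f) (ψ.rename f)
  | _, _, quant Δ K φ, f => quant Δ K (fun n δ => (φ n δ).rename (liftVar f))

lemma sat_rename (t : RTree Γ.Letter) {m : ℕ} (φ : LForm Γ k m) {m' : ℕ} (f : Fin m → Fin m')
    (ν : Fin m' → List ℕ) : Sat t (φ.rename f) ν ↔ Sat t φ (fun x => ν (f x)) := by
  induction φ generalizing m' with
  | not φ ih => exact not_congr (ih f ν)
  | and φ ψ ih ih' => exact and_congr (ih f ν) (ih' f ν)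
  | or φ ψ ih ih' => exact or_congr (ih f ν) (ih' f ν)
  | quant Δ K φ ih =>
    simp only [rename, Sat, ih, snoc_comp_liftVar]
  | _ => exact Iff.rfl

lemma inLind_rename {m : ℕ} (φ : LForm Γ k m) {m' : ℕ} (f : Fin m → Fin m')
    (h : InLind 𝒦 φ) : InLind 𝒦 (φ.rename f) := by
  induction φ generalizing m' with
  | not φ ih => exact ih f h
  | and φ ψ ih ih' => exact ⟨ih f h.1, ih' f h.2⟩
  | or φ ψ ih ih' => exact ⟨ih f h.1, ih' f h.2⟩
  | quant Δ K φ ih =>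
    refine ⟨h.1, h.2.1, ?_, fun n δ => ih n δ _ (h.2.2.2 n δ)⟩
    intro t ht ν hν p n a ha
    simp only [sat_rename, snoc_comp_liftVar]
    exact h.2.2.1 t ht _ (fun x => hν (f x)) p n a ha
  | _ => trivial

end rename

section substitution

/-- The variable `x` is interpreted by a node of rank `n`. -/
noncomputable def hasRank (n : ℕ) {m : ℕ} (x : Fin m) : LForm Γ k m :=
  iOr (fun a : Γ.Letter n => letter a x)

lemma sat_hasRank (t : RTree Γ.Letter) (n : ℕ) {m : ℕ} (x : Fin m) (ν : Fin m → List ℕ) :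
    Sat t (hasRank (k := k) n x) ν ↔ ∃ a : Γ.Letter n, t.labelAt (ν x) = some ⟨n, a⟩ := by
  rw [hasRank, sat_iOr]
  rfl

/-- Substitution of the formulas `θ_δ(x)` for the atoms `P_δ(x)`. The rank of the node is asserted
as well, since nothing is known about `θ_δ(x)` when `x` is a node of another rank than `δ`. -/
noncomputable def substLetters (θ : ∀ n, Δ.Letter n → LForm Γ k 1) :
    {m : ℕ} → LForm Δ k m → LForm Γ k m
  | _, tt => tt
  | _, ff => ff
  | _, letter (n := n) a x => and (hasRank n x) ((θ n a).rename (fun _ => x))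
  | _, lt x y => lt x y
  | _, succ i x y => succ i x y
  | _, root x => root x
  | _, max i j x => max i j x
  | _, left j x => left j x
  | _, right j x => right j x
  | _, not φ => not (substLetters θ φ)
  | _, and φ ψ => and (substLetters θ φ) (substLetters θ ψ)
  | _, or φ ψ => or (substLetters θ φ) (substLetters θ ψ)
  | _, quant Δ' K φ => quant Δ' K (fun n δ => substLetters θ (φ n δ))

lemma snoc_mem {m : ℕ} {N : Set (List ℕ)} {ν : Fin m → List ℕ} (hν : ∀ x, ν x ∈ N) {p : List ℕ}
    (hp : p ∈ N) (x : Fin (m + 1)) : (Fin.snoc ν p : Fin (m + 1) → List ℕ) x ∈ N := by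
  refine Fin.lastCases ?_ (fun i => ?_) x
  · simpa using hp
  · simpa using hν i

variable {θ : ∀ n, Δ.Letter n → LForm Γ k 1}

/-- The tree `s` is obtained from `t` by relabeling each node by the letter `δ` such that `θ_δ`
holds at this node. -/
def IsCharTree (θ : ∀ n, Δ.Letter n → LForm Γ k 1) (t : RTree Γ.Letter) (s : RTree Δ.Letter) :
    Prop :=
  s.shape = t.shape ∧ ∀ (p : List ℕ) (n : ℕ) (δ : Δ.Letter n), s.labelAt p = some ⟨n, δ⟩ →
    Sat t (θ n δ) (fun _ => p)

lemma snoc_elim0 (ν : Fin 0 → List ℕ) (p : List ℕ) :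
    (Fin.snoc ν p : Fin 1 → List ℕ) = fun _ => p := by
  funext x
  refine Fin.lastCases ?_ (fun i => i.elim0) x
  exact Fin.snoc_last (α := fun _ => List ℕ) p ν

lemma Deterministic.existsUnique (hθ : Deterministic Δ θ) {t : RTree Γ.Letter} (ht : rank t = k)
    {p : List ℕ} {n : ℕ} {a : Γ.Letter n} (ha : t.labelAt p = some ⟨n, a⟩) :
    ∃! δ : Δ.Letter n, Sat t (θ n δ) (fun _ => p) := by
  have := hθ t ht Fin.elim0 (fun x => x.elim0) p n a ha
  simpa only [snoc_elim0] using this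

lemma exists_isCharTree (hθ : Deterministic Δ θ)
    (hΔ : ∀ n, Nonempty (Γ.Letter n) → Nonempty (Δ.Letter n)) {t : RTree Γ.Letter}
    (ht : rank t = k) : ∃ s, IsCharTree θ t s := by
  have h : ∀ (p : List ℕ) (n : ℕ) (a : Γ.Letter n), ∃ δ : Δ.Letter n,
      t.labelAt p = some ⟨n, a⟩ → Sat t (θ n δ) (fun _ => p) := by
    intro p n a
    by_cases ha : t.labelAt p = some ⟨n, a⟩
    · obtain ⟨δ, hδ, -⟩ := hθ.existsUnique ht ha
      exact ⟨δ, fun _ => hδ⟩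
    · obtain ⟨δ⟩ := hΔ n ⟨a⟩
      exact ⟨δ, fun h => absurd h ha⟩
  choose f hf using h
  refine ⟨t.relabel f, RTree.shape_relabel t f, fun p n δ hδ => ?_⟩
  rw [RTree.labelAt_relabel] at hδ
  cases ha : t.labelAt p with
  | none => rw [ha] at hδ; cases hδ
  | some l =>
    obtain ⟨m, a⟩ := l
    rw [ha, Option.map_some, Option.some_inj, Sigma.mk.injEq] at hδ
    obtain ⟨rfl, e⟩ := hδ
    rw [← eq_of_heq e]
    exact hf p _ a ha

/-- A formula holds in the characteristic tree if and only if the formula obtained by substitution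
holds in the original tree. -/
lemma sat_substLetters (hθ : Deterministic Δ θ) {t : RTree Γ.Letter} (ht : rank t = k)
    {s : RTree Δ.Letter} (hs : IsCharTree θ t s) {m : ℕ} (χ : LForm Δ k m) (ν : Fin m → List ℕ)
    (hν : ∀ x, ν x ∈ t.NV) : Sat t (substLetters θ χ) ν ↔ Sat s χ ν := by
  induction χ with
  | @letter m n δ x =>
    refine Iff.trans (and_congr (sat_hasRank _ _ _ _) (sat_rename _ _ _ _)) ?_
    change _ ↔ s.labelAt (ν x) = some ⟨n, δ⟩
    constructor
    · rintro ⟨⟨a, ha⟩, h⟩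
      obtain ⟨δ', hδ'⟩ := RTree.exists_labelAt_of_shape_eq hs.1.symm ha
      rw [hδ', (hθ.existsUnique ht ha).unique (hs.2 _ _ _ hδ') h]
    · intro h
      exact ⟨RTree.exists_labelAt_of_shape_eq hs.1 h, hs.2 _ _ _ h⟩
  | max i j x =>
    refine and_congr (RTree.subtree_var_of_shape_eq hs.1.symm _) ?_
    rw [RTree.varsBefore_eq_of_shape_eq hs.1]
  | left j x =>
    change t.varsBefore (ν x) = _ ↔ s.varsBefore (ν x) = _
    rw [RTree.varsBefore_eq_of_shape_eq hs.1]
  | right j x =>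
    have e := RTree.varsBefore_eq_of_shape_eq hs.1 (ν x)
    constructor
    · rintro ⟨y, hy, h⟩
      obtain ⟨z, hz, hyz⟩ := RTree.exists_subtree_of_shape_eq hs.1.symm hy
      refine ⟨z, hz, ?_⟩
      rw [e]
      exact (congrArg _ hyz).trans h
    · rintro ⟨y, hy, h⟩
      obtain ⟨z, hz, hyz⟩ := RTree.exists_subtree_of_shape_eq hs.1 hy
      refine ⟨z, hz, ?_⟩
      rw [← e]
      exact (congrArg _ hyz).trans h
  | not φ ih => exact not_congr (ih ν hν)
  | and φ ψ ih ih' => exact and_congr (ih ν hν) (ih' ν hν)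
  | or φ ψ ih ih' => exact or_congr (ih ν hν) (ih' ν hν)
  | quant Δ' K φ ih =>
    simp only [substLetters, Sat, hs.1]
    refine exists_congr fun r => and_congr_right fun _ => and_congr_right fun hr => ?_
    refine forall_congr' fun p => forall_congr' fun n => forall_congr' fun δ =>
      forall_congr' fun hp => ih n δ _ (snoc_mem hν ?_)
    rw [← RTree.NV_eq_of_shape_eq hr]
    exact ⟨_, hp⟩
  | _ => exact Iff.rfl

lemma inLind_substLetters (hθ : Deterministic Δ θ) (hθ' : ∀ n δ, InLind 𝒦 (θ n δ))
    (hΔ : ∀ n, Nonempty (Γ.Letter n) → Nonempty (Δ.Letter n)) {m : ℕ} (χ : LForm Δ k m)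
    (hχ : InLind 𝒦 χ) : InLind 𝒦 (substLetters θ χ) := by
  induction χ with
  | @letter m n δ x => exact ⟨inLind_iOr _ fun _ => trivial, inLind_rename _ _ (hθ' n δ)⟩
  | not φ ih => exact ih hχ
  | and φ ψ ih ih' => exact ⟨ih hχ.1, ih' hχ.2⟩
  | or φ ψ ih ih' => exact ⟨ih hχ.1, ih' hχ.2⟩
  | quant Δ' K φ ih =>
    refine ⟨hχ.1, fun n h => hχ.2.1 n (hΔ n h), ?_, fun n δ => ih n δ (hχ.2.2.2 n δ)⟩
    intro t ht ν hν p n a ha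
    obtain ⟨s, hs⟩ := exists_isCharTree hθ hΔ ht
    obtain ⟨b, hb⟩ := RTree.exists_labelAt_of_shape_eq hs.1.symm ha
    have e := RTree.NV_eq_of_shape_eq hs.1
    have h : ∀ δ, Sat t (substLetters θ (φ n δ)) (Fin.snoc ν p) ↔
        Sat s (φ n δ) (Fin.snoc ν p) := fun δ =>
      sat_substLetters hθ ht hs _ _ (snoc_mem hν ⟨_, ha⟩)
    simp only [h]
    exact hχ.2.2.1 s ((RTree.numVars_eq_of_shape_eq hs.1).trans ht) ν
      (fun x => by rw [e]; exact hν x) p n b hb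
  | _ => trivial

end substitution

section definable

/-- The relation `D` between trees of rank `k` and tuples of `m` nodes is defined by a formula of
`𝐋𝐢𝐧𝐝(𝒦)` with `m` free variables. -/
def Definable (𝒦 : LanguageClass) (Γ : RankedAlphabet) (k m : ℕ)
    (D : RTree Γ.Letter → (Fin m → List ℕ) → Prop) : Prop :=
  ∃ ψ : LForm Γ k m, InLind 𝒦 ψ ∧ ∀ t : RTree Γ.Letter, rank t = k → t ≠ .var →
    ∀ ν, (∀ x, ν x ∈ t.NV) → (Sat t ψ ν ↔ D t ν)

variable {m : ℕ} {D D' : RTree Γ.Letter → (Fin m → List ℕ) → Prop}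

lemma Definable.congr (h : Definable 𝒦 Γ k m D)
    (e : ∀ t : RTree Γ.Letter, rank t = k → t ≠ .var → ∀ ν, (∀ x, ν x ∈ t.NV) →
      (D t ν ↔ D' t ν)) : Definable 𝒦 Γ k m D' := by
  obtain ⟨ψ, hψ, h⟩ := h
  exact ⟨ψ, hψ, fun t ht ht' ν hν => (h t ht ht' ν hν).trans (e t ht ht' ν hν)⟩

lemma Definable.not (h : Definable 𝒦 Γ k m D) : Definable 𝒦 Γ k m (fun t ν => ¬ D t ν) := by
  obtain ⟨ψ, hψ, h⟩ := h
  exact ⟨.not ψ, hψ, fun t ht ht' ν hν => not_congr (h t ht ht' ν hν)⟩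

lemma Definable.and (h : Definable 𝒦 Γ k m D) (h' : Definable 𝒦 Γ k m D') :
    Definable 𝒦 Γ k m (fun t ν => D t ν ∧ D' t ν) := by
  obtain ⟨ψ, hψ, h⟩ := h
  obtain ⟨ψ', hψ', h'⟩ := h'
  exact ⟨.and ψ ψ', ⟨hψ, hψ'⟩, fun t ht ht' ν hν =>
    and_congr (h t ht ht' ν hν) (h' t ht ht' ν hν)⟩

lemma Definable.or (h : Definable 𝒦 Γ k m D) (h' : Definable 𝒦 Γ k m D') :
    Definable 𝒦 Γ k m (fun t ν => D t ν ∨ D' t ν) := by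
  obtain ⟨ψ, hψ, h⟩ := h
  obtain ⟨ψ', hψ', h'⟩ := h'
  exact ⟨.or ψ ψ', ⟨hψ, hψ'⟩, fun t ht ht' ν hν =>
    or_congr (h t ht ht' ν hν) (h' t ht ht' ν hν)⟩

lemma Definable.const (c : Prop) : Definable 𝒦 Γ k m (fun _ _ => c) := by
  by_cases hc : c
  · exact ⟨.tt, trivial, fun t ht ht' ν hν => ⟨fun _ => hc, fun _ => trivial⟩⟩
  · exact ⟨.ff, trivial, fun t ht ht' ν hν => ⟨False.elim, hc⟩⟩

lemma Definable.exists {ι : Type*} [Finite ι]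
    {D : ι → RTree Γ.Letter → (Fin m → List ℕ) → Prop} (h : ∀ i, Definable 𝒦 Γ k m (D i)) :
    Definable 𝒦 Γ k m (fun t ν => ∃ i, D i t ν) := by
  choose ψ hψ h using h
  exact ⟨iOr ψ, inLind_iOr ψ hψ, fun t ht ht' ν hν =>
    (sat_iOr t ν ψ).trans (exists_congr fun i => h i t ht ht' ν hν)⟩

lemma Definable.forall {ι : Type*} [Finite ι]
    {D : ι → RTree Γ.Letter → (Fin m → List ℕ) → Prop} (h : ∀ i, Definable 𝒦 Γ k m (D i)) :
    Definable 𝒦 Γ k m (fun t ν => ∀ i, D i t ν) :=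
  (Definable.exists fun i => (h i).not).not.congr fun t _ _ ν _ => by simp

/-- A relation that depends only on finitely many values of a function is definable if the fibers
of the function are. -/
lemma Definable.of_fibers {X : Type*} {V : Set X} (hV : V.Finite)
    (F : RTree Γ.Letter → (Fin m → List ℕ) → X)
    (hF : ∀ t : RTree Γ.Letter, rank t = k → ∀ ν, (∀ x, ν x ∈ t.NV) → F t ν ∈ V)
    (h : ∀ x ∈ V, Definable 𝒦 Γ k m (fun t ν => F t ν = x)) (R : Set X) :
    Definable 𝒦 Γ k m (fun t ν => F t ν ∈ R) := by
  have := hV.to_subtype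
  refine (Definable.exists fun x : V => (h x x.2).and (Definable.const (x.1 ∈ R))).congr ?_
  intro t ht _ ν hν
  constructor
  · rintro ⟨x, hx, h⟩
    simpa only [hx] using h
  · intro hx
    exact ⟨⟨_, hF t ht ν hν⟩, rfl, hx⟩

lemma mem_lindClass_iff {L : TreeLanguage Γ k} :
    L ∈ LindClass 𝒦 Γ k ↔ Definable 𝒦 Γ k 0 (fun t _ => ∃ h : rank t = k, ⟨t, h⟩ ∈ L) := by
  constructor
  · rintro ⟨φ, hφ, h⟩
    refine ⟨φ, hφ, fun t ht ht' ν _ => ?_⟩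
    rw [Subsingleton.elim ν Fin.elim0]
    exact (h ⟨t, ht⟩ ht').symm.trans ⟨fun h => ⟨ht, h⟩, fun ⟨_, h⟩ => h⟩
  · rintro ⟨φ, hφ, h⟩
    refine ⟨φ, hφ, fun t ht' => ?_⟩
    exact Iff.trans ⟨fun h => ⟨t.2, h⟩, fun ⟨_, h⟩ => h⟩
      (h t.1 t.2 ht' Fin.elim0 (fun x => x.elim0)).symm

/-- Lindström quantification over a language that is only known to be definable, not to belong to
the class `𝒦`: if `G` computes the new letters at all nodes, and its fibers are definable, then the
inverse image under relabeling of a definable language is definable. -/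
lemma Definable.relabel {E : RTree Δ.Letter → Prop} (hE : Definable 𝒦 Δ k 0 (fun s _ => E s))
    (hΔ : ∀ n, Nonempty (Γ.Letter n) → Nonempty (Δ.Letter n))
    (G : RTree Γ.Letter → List ℕ → ∀ n, Γ.Letter n → Δ.Letter n)
    (hG : ∀ n (δ : Δ.Letter n), Definable 𝒦 Γ k 1
      (fun t ν => ∃ a, t.labelAt (ν 0) = some ⟨n, a⟩ ∧ G t (ν 0) n a = δ)) :
    Definable 𝒦 Γ k 0 (fun t _ => E (t.relabel (G t))) := by
  obtain ⟨χ, hχ, hE⟩ := hE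
  choose θ hθ hG using hG
  have hNV : ∀ {t : RTree Γ.Letter} {p : List ℕ} {n : ℕ} {a : Γ.Letter n},
      t.labelAt p = some ⟨n, a⟩ → t ≠ .var := by
    rintro t p n a ha rfl
    rw [RTree.labelAt_var] at ha
    cases ha
  have key : ∀ {t : RTree Γ.Letter}, rank t = k → ∀ {p : List ℕ} {n : ℕ} {a : Γ.Letter n},
      t.labelAt p = some ⟨n, a⟩ → ∀ δ, Sat t (θ n δ) (fun _ => p) ↔ G t p n a = δ := by
    intro t ht p n a ha δ
    refine (hG n δ t ht (hNV ha) _ fun _ => ⟨_, ha⟩).trans ?_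
    constructor
    · rintro ⟨b, hb, h⟩
      rw [ha, Option.some_inj, Sigma.mk.injEq] at hb
      rw [eq_of_heq hb.2]
      exact h
    · intro h
      exact ⟨a, ha, h⟩
  have hdet : Deterministic Δ θ := by
    intro t ht ν _ p n a ha
    simp only [snoc_elim0, key ht ha]
    exact ⟨_, rfl, fun _ h => h.symm⟩
  refine ⟨substLetters θ χ, inLind_substLetters hdet hθ hΔ χ hχ, fun t ht ht' ν hν => ?_⟩
  have hs : (t.relabel (G t)).shape = t.shape := RTree.shape_relabel t _
  have hchar : IsCharTree θ t (t.relabel (G t)) := by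
    refine ⟨hs, fun p n δ hδ => ?_⟩
    obtain ⟨a, ha⟩ := RTree.exists_labelAt_of_shape_eq hs hδ
    rw [RTree.labelAt_relabel, ha, Option.map_some, Option.some_inj, Sigma.mk.injEq] at hδ
    exact (key ht ha δ).2 (eq_of_heq hδ.2)
  refine (sat_substLetters hdet ht hchar χ ν hν).trans (hE _ ?_ ?_ ν fun x => x.elim0)
  · exact (RTree.numVars_eq_of_shape_eq hs).trans ht
  · rwa [Ne, ← RTree.shape_eq_var, hs, RTree.shape_eq_var]

end definable

end LForm

/-! ### Contexts of the nodes of a tree and evaluation in the block product -/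

namespace Preclone

/-- The number of variables of a composition that lie to the left of its `i`-th component. -/
def offset {T : Type v} [Preclone T] (g : ℕ → T) (i : ℕ) : ℕ := ∑ l ∈ Finset.range i, rank (g l)

lemma offset_succ {T : Type v} [Preclone T] (g : ℕ → T) (i : ℕ) :
    offset g (i + 1) = offset g i + rank (g i) := Finset.sum_range_succ _ _

lemma offset_mono {T : Type v} [Preclone T] (g : ℕ → T) {i j : ℕ} (h : i ≤ j) :
    offset g i ≤ offset g j := Finset.sum_le_sum_of_subset (Finset.range_mono h)

lemma sum_range_offset {T : Type v} [Preclone T] (g : ℕ → T) (F : ℕ → ℕ) (i : ℕ) :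
    ∑ j ∈ Finset.range (offset g i), F j =
      ∑ j ∈ Finset.range i, ∑ l ∈ Finset.range (rank (g j)), F (offset g j + l) := by
  induction i with
  | zero => rfl
  | succ i ih => rw [offset_succ, Finset.sum_range_add, ih, Finset.sum_range_succ]

lemma offset_update {T : Type v} [Preclone T] (g : ℕ → T) (i : ℕ) (x : T) (j : ℕ) :
    offset (fun l => if l = i then x else g l) j + (if i < j then rank (g i) else 0) =
      offset g j + (if i < j then rank x else 0) := by
  unfold offset
  simp only [apply_ite rank]
  by_cases h : i < j
  · rw [if_pos h, if_pos h]
    exact sum_range_update h (fun l => rank (g l)) (rank x)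
  · rw [if_neg h, if_neg h]
    congr 1
    refine Finset.sum_congr rfl fun l hl => if_neg ?_
    have := Finset.mem_range.1 hl
    omega

end Preclone

/-- A context in which the tuple is indexed by all natural numbers and the total rank is not
prescribed. Only the initial entries of the tuple matter; the others are arbitrary. -/
@[ext]
structure SeqContext (T : Type v) where
  u : T
  k₁ : ℕ
  v : ℕ → T

namespace SeqContext

variable {S : Type u} {T : Type v} [Preclone S] [Preclone T] {k n : ℕ}

/-- The sequence `c` represents the context `C`. -/
structure Represents (c : SeqContext T) (C : Context T k n) : Prop where
  u_eq : C.u = c.u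
  k₁_eq : C.k₁ = c.k₁
  v_eq : ∀ i : Fin n, C.v i = c.v i

/-- The sequence `c` represents an `n`-ary context in `T_k`. -/
def Valid (c : SeqContext T) (k n : ℕ) : Prop := ∃ C : Context T k n, c.Represents C

lemma Represents.unique {c : SeqContext T} {C D : Context T k n} (hC : c.Represents C)
    (hD : c.Represents D) : C = D :=
  BlockProduct.context_ext (hC.u_eq.trans hD.u_eq.symm) (hC.k₁_eq.trans hD.k₁_eq.symm)
    (funext fun i => (hC.v_eq i).trans (hD.v_eq i).symm)

lemma Valid.lt_rank {c : SeqContext T} (h : c.Valid k n) : c.k₁ < rank c.u := by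
  obtain ⟨C, hu, h₁, -⟩ := h
  have := C.rank_u
  rw [hu, h₁] at this
  omega

/-- The sequence that represents a given context. -/
def ofContext (C : Context T k n) : SeqContext T where
  u := C.u
  k₁ := C.k₁
  v := fun i => if h : i < n then C.v ⟨i, h⟩ else one

lemma represents_ofContext (C : Context T k n) : (ofContext C).Represents C :=
  ⟨rfl, rfl, fun i => by simp [ofContext]⟩

/-- The context of the upper factor of a composition. -/
def above (c : SeqContext T) (g : ℕ → T) : SeqContext T where
  u := c.u
  k₁ := c.k₁
  v := fun i => comp (g i) (fun j => c.v (offset g i + j))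

/-- The context of the `i`-th component of a composition. -/
def below (c : SeqContext T) (f : T) (g : ℕ → T) (i : ℕ) : SeqContext T where
  u := plug c.u c.k₁ (comp f (fun j => if (j : ℕ) = i then one else (c.above g).v j))
  k₁ := c.k₁ + ∑ j ∈ Finset.range i, rank ((c.above g).v j)
  v := fun j => c.v (offset g i + j)

lemma rank_above_v (c : SeqContext T) (g : ℕ → T) (i : ℕ) :
    rank ((c.above g).v i) = ∑ l ∈ Finset.range (rank (g i)), rank (c.v (offset g i + l)) :=
  rank_comp_nat (g i) (fun l => c.v (offset g i + l))

variable {f : T} {g : ℕ → T}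

lemma Represents.block {c : SeqContext T}
    {C : Context T k (rank (comp f (fun i => g i)))} (h : c.Represents C) (i : Fin (rank f))
    (j : Fin (rank (g i))) :
    Context.block (g := fun i : Fin (rank f) => g i) C i j = c.v (offset g i + j) := by
  refine (h.v_eq _).trans (congrArg c.v ?_)
  refine (sigma_val (fun i : Fin (rank f) => rank (g i)) i j).trans ?_
  rw [sum_Iio_eq_sum_range (fun l => rank (g l)) i]
  rfl

lemma Represents.above_v {c : SeqContext T}
    {C : Context T k (rank (comp f (fun i => g i)))} (h : c.Represents C) (i : Fin (rank f)) :
    comp (g i) (Context.block (g := fun i : Fin (rank f) => g i) C i) = (c.above g).v i :=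
  congrArg (comp (g i)) (funext fun j => h.block i j)

lemma Represents.above {c : SeqContext T}
    {C : Context T k (rank (comp f (fun i => g i)))} (h : c.Represents C) :
    (c.above g).Represents C.above :=
  ⟨h.u_eq, h.k₁_eq, fun i => h.above_v i⟩

lemma Represents.below {c : SeqContext T}
    {C : Context T k (rank (comp f (fun i => g i)))} (h : c.Represents C) (i : Fin (rank f)) :
    (c.below f g i).Represents (C.below i) := by
  refine ⟨?_, ?_, h.block i⟩
  · change plug C.u C.k₁ _ = plug c.u c.k₁ _
    rw [h.u_eq, h.k₁_eq]
    congr 1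
    refine comp_congr rfl _ _ fun j => ?_
    simp only [h.above_v, Fin.ext_iff]
    rfl
  · change C.k₁ + _ = c.k₁ + _
    rw [h.k₁_eq, ← sum_Iio_eq_sum_range (fun j => rank ((c.above g).v j)) i]
    congr 1
    refine Finset.sum_congr rfl fun j _ => ?_
    rw [← h.above_v, rank_comp]

lemma Valid.above {c : SeqContext T} (h : c.Valid k (rank (comp f (fun i => g i)))) :
    (c.above g).Valid k (rank f) := by
  obtain ⟨C, hC⟩ := h
  exact ⟨_, hC.above⟩

lemma Valid.below {c : SeqContext T} (h : c.Valid k (rank (comp f (fun i => g i)))) {i : ℕ}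
    (hi : i < rank f) : (c.below f g i).Valid k (rank (g i)) := by
  obtain ⟨C, hC⟩ := h
  exact ⟨_, hC.below ⟨i, hi⟩⟩

end SeqContext

namespace BlockProduct

variable {S : Type u} {T : Type v} [Preclone S] [Preclone T] {k : ℕ}

open Classical in
/-- The value of the first component of an element of the block product at the context represented
by `c`; it is `𝟏` if `c` represents no context. -/
noncomputable def eval (X : BlockProduct k S T) (c : SeqContext T) : S :=
  if h : c.Valid k (rank X.snd) then X.fst h.choose else one

lemma eval_eq (X : BlockProduct k S T) {c : SeqContext T} {C : Context T k (rank X.snd)}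
    (h : c.Represents C) : X.eval c = X.fst C := by
  have h' : c.Valid k (rank X.snd) := ⟨C, h⟩
  rw [eval, dif_pos h', h'.choose_spec.unique h]

lemma eval_one (c : SeqContext T) : (one : BlockProduct k S T).eval c = one := by
  unfold eval
  split_ifs <;> rfl

lemma eval_comp (X : BlockProduct k S T) (G : ℕ → BlockProduct k S T) {c : SeqContext T}
    (h : c.Valid k (rank (comp X.snd (fun i => (G i).snd)))) :
    (comp X (fun i => G i)).eval c = comp (X.eval (c.above (fun i => (G i).snd)))
      (fun i => (G i).eval (c.below X.snd (fun i => (G i).snd) i)) := by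
  obtain ⟨C, hC⟩ := h
  refine (eval_eq (comp X (fun i => G i)) hC).trans ?_
  refine comp_congr (eval_eq X (SeqContext.Represents.above (f := X.snd)
    (g := fun i => (G i).snd) hC)).symm _ _ fun i => ?_
  exact (eval_eq (G i) (SeqContext.Represents.below (f := X.snd) (g := fun i => (G i).snd) hC
    (Fin.cast (X.rank_fst _) i))).symm

lemma ext_eval {X Y : BlockProduct k S T} (h : X.snd = Y.snd) {n : ℕ} (hn : rank X.snd = n)
    (hF : ∀ C : Context T k n,
      X.eval (SeqContext.ofContext C) = Y.eval (SeqContext.ofContext C)) : X = Y := by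
  subst hn
  refine ext' h fun C => ?_
  have hC := SeqContext.represents_ofContext C
  rw [← eval_eq X hC, hF, eval_eq Y (C := C.cast (congrArg rank h)) ⟨rfl, rfl, ?_⟩]
  intro i
  exact hC.v_eq (Fin.cast _ i)

lemma isMorphism_snd {A : ℕ → Type} {φ : RTree A → BlockProduct k S T} (hφ : IsMorphism φ) :
    IsMorphism (fun t => (φ t).snd) where
  map_rank := hφ.map_rank
  map_one := congrArg snd hφ.map_one
  map_comp f g := congrArg snd (hφ.map_comp f g)

end BlockProduct

namespace RTree

variable {A B : ℕ → Type}

/-- The subtree at an address, and the tree `𝟏` if the address does not belong to the tree. -/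
def subtreeD (t : RTree A) (p : List ℕ) : RTree A := (t.subtree p).getD var

lemma subtreeD_node_nil {n : ℕ} (a : A n) (ts : Fin n → RTree A) (i : ℕ) :
    (node a ts).subtreeD [i] = kid ts i := by
  by_cases h : i < n
  · rw [subtreeD, subtree_node_cons a ts h, subtree_nil]
    rfl
  · rw [subtreeD, subtree_node_cons_of_ge a ts h, kid, dif_neg h]
    rfl

lemma subtreeD_node_cons {n : ℕ} (a : A n) (ts : Fin n → RTree A) {i : ℕ} (h : i < n)
    (p : List ℕ) : (node a ts).subtreeD (i :: p) = (kid ts i).subtreeD p := by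
  rw [subtreeD, subtree_node_cons a ts h]
  rfl

end RTree

namespace SeqContext

variable {S : Type u} {T : Type v} [Preclone S] [Preclone T] {k : ℕ}

/-- The context of a node of a tree of rank `N` whose context is `c`, in terms of the number `a` of
variables to the left of the node, the value `d` of the tree from which the subtree at this node
has been removed, and the values `e` of the subtrees at the children of the node. -/
def ofData (c : SeqContext T) (N a : ℕ) (d : T) (e : ℕ → T) : SeqContext T where
  u := plug c.u c.k₁ (comp d
    (fun i => if (i : ℕ) < a then c.v i else if (i : ℕ) = a then one else c.v (i + N - rank d)))
  k₁ := c.k₁ + ∑ j ∈ Finset.range a, rank (c.v j)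
  v := fun i => comp (e i) (fun j => c.v (a + offset e i + j))

variable {A B : ℕ → Type} {τ : RTree A → T}

/-- The context of the node `p` of the tree `t` with context `c`. -/
def atNode (τ : RTree A → T) (c : SeqContext T) (t : RTree A) (p : List ℕ) : SeqContext T :=
  c.ofData (rank t) (t.varsBefore p) (τ (t.replaceAt p .var)) (fun i => τ (t.subtreeD (p ++ [i])))

lemma atNode_nil (hτ : IsMorphism τ) (c : SeqContext T) {n : ℕ} (a : A n)
    (ts : Fin n → RTree A) :
    c.atNode τ (.node a ts) [] = c.above (fun i => τ (RTree.kid ts i)) := by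
  have e : τ ((RTree.node a ts).replaceAt [] .var) = one := hτ.map_one
  have e' : (fun i => τ ((RTree.node a ts).subtreeD ([] ++ [i]))) =
      fun i => τ (RTree.kid ts i) := funext fun i => congrArg τ (RTree.subtreeD_node_nil a ts i)
  unfold atNode
  rw [e, e', RTree.varsBefore_nil]
  refine SeqContext.ext ?_ ?_ ?_
  · refine Eq.trans (congrArg (plug c.u c.k₁) ?_) (plug_unit c.u c.k₁)
    exact one_comp_nat (fun i => if i < 0 then c.v i else if i = 0 then one else
      c.v (i + rank (RTree.node a ts) - rank (one : T)))
  · rfl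
  · funext i
    change comp _ _ = comp _ _
    simp only [Nat.zero_add]

/-- Contexts can be computed step by step along the path from the root to a node. -/
lemma atNode_cons (hτ : IsMorphism τ) {c : SeqContext T} (hc : c.k₁ < rank c.u) {n : ℕ} (a : A n)
    (ts : Fin n → RTree A) {i : ℕ} (hi : i < n) {q : List ℕ} {s : RTree A}
    (hs : (RTree.kid ts i).subtree q = some s) :
    c.atNode τ (.node a ts) (i :: q) =
      (c.below (τ (RTree.letter a)) (fun i => τ (RTree.kid ts i)) i).atNode τ
        (RTree.kid ts i) q := by
  set g : ℕ → T := fun i => τ (RTree.kid ts i) with hg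
  set f := τ (RTree.letter a) with hf
  have hoff : ∀ j, ∑ l ∈ Finset.range j, (RTree.kid ts l).numVars = offset g j := fun j =>
    Finset.sum_congr rfl fun l _ => (hτ.map_rank _).symm
  have hif : i < rank f := by rwa [hf, hτ.map_rank, RTree.rank_letter]
  set r := (RTree.kid ts i).replaceAt q .var with hr
  set b := (RTree.kid ts i).varsBefore q with hb
  have hd : τ ((RTree.node a ts).replaceAt (i :: q) .var) =
      comp f (fun j => if (j : ℕ) = i then τ r else g j) := by
    rw [RTree.replaceAt, RTree.map_node hτ]
    refine comp_congr rfl _ _ fun j => ?_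
    rw [RTree.kid_replaceAt ts hi]
    exact apply_ite τ _ _ _
  have ha : (RTree.node a ts).varsBefore (i :: q) = offset g i + b := by
    rw [RTree.varsBefore_node_cons a ts hi, hoff]
  have he : (fun l => τ ((RTree.node a ts).subtreeD (i :: q ++ [l]))) =
      fun l => τ ((RTree.kid ts i).subtreeD (q ++ [l])) :=
    funext fun l => congrArg τ (RTree.subtreeD_node_cons a ts hi _)
  have hrank : rank (RTree.kid ts i) = rank (g i) := (hτ.map_rank _).symm
  have hrankr : rank (τ r) + rank s = rank (g i) + 1 := by
    rw [hτ.map_rank, hg, hτ.map_rank]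
    exact RTree.numVars_replaceAt hs _
  have hb' : b + 1 ≤ rank (τ r) := by
    rw [hτ.map_rank, hb, ← RTree.varsBefore_replaceAt hs .var]
    exact RTree.varsBefore_add_le (RTree.subtree_replaceAt hs .var)
  -- Replacing the component `i` by `r` shifts the variables of the later components only.
  have hsrank : ∀ j, offset (fun l => if l = i then τ r else g l) j +
      (if i < j then rank (g i) else 0) = offset g j + (if i < j then rank (τ r) else 0) :=
    offset_update g i (τ r)
  have hN : rank (RTree.node a ts) = offset g n :=
    (RTree.numVars_node a ts).trans (hoff n)
  have hrankd : rank (comp f (fun j => if (j : ℕ) = i then τ r else g j)) =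
      offset (fun l => if l = i then τ r else g l) n := by
    rw [rank_comp_nat f (fun j => if j = i then τ r else g j), hf, hτ.map_rank,
      RTree.rank_letter]
    rfl
  have hn := hsrank n
  rw [if_pos hi, if_pos hi, ← hrankd] at hn
  unfold atNode
  rw [hd, ha, he, hN, hrank]
  refine SeqContext.ext ?_ ?_ ?_
  · unfold ofData below
    dsimp only
    have hX : ∑ j ∈ Finset.range i, rank ((c.above g).v j) <
        rank (comp f (fun j => if (j : ℕ) = i then one else (c.above g).v j)) := by
      rw [rank_comp_nat f (fun j => if j = i then one else (c.above g).v j)]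
      have := sum_range_le hif (fun j => rank (if j = i then one else (c.above g).v j))
      rw [if_pos rfl, rank_one] at this
      refine lt_of_lt_of_le (lt_of_eq_of_lt ?_ (Nat.lt_succ_self _)) this
      refine Finset.sum_congr rfl fun j hj => ?_
      rw [if_neg (Finset.mem_range.1 hj).ne]
    rw [plug_plug _ _ hc _ _ hX, plug_comp_update f (c.above g).v hif]
    congr 1
    set D := rank (comp f (fun j => if (j : ℕ) = i then τ r else g j)) with hD
    set W : ℕ → T := fun l => if l < offset g i + b then c.v l else
      if l = offset g i + b then one else c.v (l + offset g n - D) with hW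
    set W' : ℕ → T := fun l => if l < b then c.v (offset g i + l) else
      if l = b then one else c.v (offset g i + (l + rank (g i) - rank (τ r))) with hW'
    refine (comp_comp_nat f (fun j => if j = i then τ r else g j) W).trans ?_
    refine comp_congr_nat (w := fun j => comp (if j = i then τ r else g j)
        (fun l => W (offset (fun l => if l = i then τ r else g l) j + l)))
      (w' := fun j => if j = i then comp (τ r) (fun l => W' l) else (c.above g).v j)
      rfl fun j _ => ?_
    have hj := hsrank j
    -- The variables under the component number `j < i` lie to the left of the node, so that they
    -- are not shifted; under the component `i` the context is split at the node; under `j > i` all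
    -- variables are shifted by the difference of the ranks of the subtree and of a variable.
    rcases lt_trichotomy j i with h | h | h
    · rw [if_neg (by omega), if_neg (by omega)] at hj
      rw [if_neg h.ne, if_neg h.ne]
      refine comp_congr rfl _ _ fun l => ?_
      have hl := l.2
      have h1 := offset_succ g j
      have h2 := offset_mono g (Nat.succ_le_of_lt h)
      rw [Nat.succ_eq_add_one] at h2
      exact (if_pos (by omega)).trans (congrArg c.v (by simp only [Fin.val_cast]; omega))
    · rw [if_neg (by omega), if_neg (by omega), h] at hj
      rw [if_pos h, if_pos h, h]
      refine comp_congr rfl _ _ fun l => ?_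
      simp only [hW, hW', Fin.val_cast]
      rcases lt_trichotomy (l : ℕ) b with h' | h' | h'
      · rw [if_pos (by omega), if_pos h']
        exact congrArg c.v (by omega)
      · rw [if_neg (by omega), if_pos (by omega), if_neg (by omega), if_pos h']
      · rw [if_neg (by omega), if_neg (by omega), if_neg (by omega), if_neg (by omega)]
        exact congrArg c.v (by omega)
    · rw [if_pos h, if_pos h] at hj
      rw [if_neg h.ne', if_neg h.ne']
      refine comp_congr rfl _ _ fun l => ?_
      have h1 := offset_succ g i
      have h2 := offset_mono g (Nat.succ_le_of_lt h)
      rw [Nat.succ_eq_add_one] at h2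
      exact (if_neg (by omega)).trans ((if_neg (by omega)).trans
        (congrArg c.v (by simp only [Fin.val_cast]; omega)))
  · change c.k₁ + _ = c.k₁ + ∑ j ∈ Finset.range i, rank ((c.above g).v j) + _
    rw [Finset.sum_range_add, sum_range_offset, Nat.add_assoc]
    simp only [rank_above_v]
    rfl
  · funext l
    change comp _ _ = comp _ _
    refine comp_congr rfl _ _ fun j => ?_
    exact congrArg c.v (by simp only [Fin.val_cast]; omega)

/-- The context of a node of rank `m` is an `m`-ary context. -/
lemma Valid.atNode (hτ : IsMorphism τ) (t : RTree A) {c : SeqContext T}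
    (hc : c.Valid k (rank (τ t))) {p : List ℕ} {m : ℕ} {b : A m}
    (hb : t.labelAt p = some ⟨m, b⟩) : (c.atNode τ t p).Valid k m := by
  induction p generalizing t c with
  | nil =>
    cases t with
    | var => cases hb
    | @node n a ts =>
      rw [RTree.labelAt_node_nil, Option.some_inj, Sigma.mk.injEq] at hb
      obtain ⟨rfl, -⟩ := hb
      rw [RTree.map_node hτ] at hc
      rw [atNode_nil hτ]
      have := hc.above (g := fun i => τ (RTree.kid ts i))
      rwa [hτ.map_rank, RTree.rank_letter] at this
  | cons i p ih =>
    cases t with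
    | var => cases hb
    | @node n a ts =>
      by_cases hi : i < n
      · rw [RTree.labelAt_node_cons a ts hi] at hb
        obtain ⟨ts', hs⟩ := RTree.labelAt_eq_some hb
        rw [atNode_cons hτ hc.lt_rank a ts hi hs]
        refine ih _ ?_ hb
        rw [RTree.map_node hτ] at hc
        exact hc.below (g := fun i => τ (RTree.kid ts i))
          (by rwa [hτ.map_rank, RTree.rank_letter])
      · rw [RTree.labelAt_node_cons_of_ge a ts hi] at hb
        cases hb

end SeqContext

namespace BlockProduct

variable {S : Type u} {T : Type v} [Preclone S] [Preclone T] {k : ℕ} {A B : ℕ → Type}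

/-- The first component of the value of a tree under a morphism into a block product, at a given
context, is the value in `S` of the tree in which each node is relabeled by the first component
of the value of its letter at the context of the node. -/
lemma lift_relabel {φ : RTree A → BlockProduct k S T} (hφ : IsMorphism φ) (f : ∀ n, B n → S)
    (hf : ∀ n b, rank (f n b) = n) (t : RTree A) {c : SeqContext T}
    (hc : c.Valid k (rank (φ t).snd)) (G : List ℕ → ∀ n, A n → B n)
    (hG : ∀ p n (a : A n), t.labelAt p = some ⟨n, a⟩ →
      f n (G p n a) = (φ (RTree.letter a)).eval (c.atNode (fun t => (φ t).snd) t p)) :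
    RTree.lift f hf (t.relabel G) = (φ t).eval c := by
  have hτ := isMorphism_snd hφ
  induction t generalizing c G with
  | var =>
    have : φ .var = one := hφ.map_one
    rw [this, eval_one]
    rfl
  | @node n a ts ih =>
    have hc' : c.Valid k (rank (comp (φ (RTree.letter a)).snd
        (fun i => (φ (RTree.kid ts i)).snd))) := by
      have e := RTree.map_node hτ a ts
      rwa [e] at hc
    rw [RTree.relabel, RTree.lift_node, RTree.map_node hφ,
      eval_comp _ (fun i => φ (RTree.kid ts i)) hc']
    have h0 := hG [] n a (RTree.labelAt_node_nil a ts)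
    rw [SeqContext.atNode_nil hτ] at h0
    refine comp_congr h0 _ _ fun i => ?_
    have hi : (i : ℕ) < n := lt_of_lt_of_eq i.2 (hf n _)
    rw [RTree.kid_relabel, Fin.val_cast]
    have hi' := RTree.kid_of_lt ts hi
    rw [hi']
    refine ih ⟨i, hi⟩ ?_ _ fun p m b hb => ?_
    · rw [← hi']
      exact hc'.below (g := fun i => (φ (RTree.kid ts i)).snd)
        (by rwa [hτ.map_rank, RTree.rank_letter])
    · rw [← hi'] at hb ⊢
      obtain ⟨ts', hs⟩ := RTree.labelAt_eq_some hb
      rw [← SeqContext.atNode_cons hτ hc.lt_rank a ts hi hs]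
      refine hG _ _ _ ?_
      rw [RTree.labelAt_node_cons a ts hi]
      exact hb

end BlockProduct

/-! ### Definability of the contexts of nodes -/

namespace Preclone

variable {T : Type v} [Preclone T]

lemma Finitary.finite_rank_le (hT : Finitary T) (n : ℕ) : {s : T | rank s ≤ n}.Finite := by
  have : {s : T | rank s ≤ n} = ⋃ i ∈ Set.Iic n, {s : T | rank s = i} := by
    ext s
    simp
  rw [this]
  exact (Set.finite_Iic n).biUnion fun i _ => hT i

lemma Finitary.finite_context (hT : Finitary T) (k n : ℕ) : Finite (Context T k n) := by
  have h₁ := (hT.finite_rank_le (k + 1)).to_subtype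
  have h₂ := (hT.finite_rank_le k).to_subtype
  have hv : ∀ (C : Context T k n) (i : Fin n), rank (C.v i) ≤ k := by
    intro C i
    have h : rank (C.v i) ≤ ∑ i, rank (C.v i) :=
      Finset.single_le_sum (f := fun i => rank (C.v i)) (fun _ _ => Nat.zero_le _)
        (Finset.mem_univ i)
    have := C.total
    omega
  let F : Context T k n →
      {s : T | rank s ≤ k + 1} × Fin (k + 1) × (Fin n → {s : T | rank s ≤ k}) :=
    fun C => (⟨C.u, by
        have := C.rank_u
        have := C.total
        change rank C.u ≤ k + 1
        omega⟩,
      ⟨C.k₁, by have := C.total; omega⟩, fun i => ⟨C.v i, hv C i⟩)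
  refine Finite.of_injective F fun C D h => ?_
  simp only [F, Prod.mk.injEq, Subtype.mk.injEq, Fin.mk.injEq] at h
  refine BlockProduct.context_ext h.1 h.2.1 (funext fun i => ?_)
  exact congrArg Subtype.val (congrFun h.2.2 i)

end Preclone

namespace LForm

variable {𝒦 : LanguageClass} {Γ : RankedAlphabet} {n : ℕ} {T : Type v} [Preclone T]
  {τ : RTree Γ.Letter → T}

lemma definable_letter {m : ℕ} (a : Γ.Letter m) :
    Definable 𝒦 Γ n 1 (fun t ν => t.labelAt (ν 0) = some ⟨m, a⟩) :=
  ⟨.letter a 0, trivial, fun _ _ _ _ _ => Iff.rfl⟩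

/-- The position of a node and the value of the tree from which the subtree at this node has been
removed are definable. At the root this is clear, and at the other nodes it follows from `R1`. -/
lemma definable_above (hrel : RelativizesAbove 𝒦) (hτ : IsMorphism τ)
    (hdef : ∀ l d, Definable 𝒦 Γ l 0 (fun t _ => τ t = d)) (a : ℕ) (d : T) :
    Definable 𝒦 Γ n 1
      (fun t ν => t.varsBefore (ν 0) = a ∧ τ (t.replaceAt (ν 0) .var) = d) := by
  by_cases hd : a + 1 ≤ rank d ∧ rank d ≤ n + 1
    -- The rank of `d` determines the number `b` of variables to the right of the node.
  · obtain ⟨b, hb⟩ := Nat.exists_eq_add_of_le hd.1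
    obtain ⟨φ, hφ, h⟩ := hdef (a + 1 + b) d
    obtain ⟨ψ, hψ, h'⟩ := hrel Γ a b n (by omega) φ hφ
    have hroot : Definable 𝒦 Γ n 1 (fun _ ν => ν 0 = []) :=
      ⟨.root 0, trivial, fun _ _ _ _ _ => Iff.rfl⟩
    have hψ' : Definable 𝒦 Γ n 1 (fun t ν => Sat t ψ ν) := ⟨ψ, hψ, fun _ _ _ _ _ => Iff.rfl⟩
    refine ((hroot.and (Definable.const (0 = a ∧ one = d))).or (hroot.not.and hψ')).congr
      fun t ht ht' ν hν => ?_
    obtain ⟨p, rfl⟩ : ∃ p, ν = fun _ => p := ⟨ν 0, funext fun x => by rw [Subsingleton.elim x 0]⟩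
    have hp : p ∈ t.NV := hν 0
    obtain ⟨⟨m, c⟩, hc⟩ := hp
    obtain ⟨ts, hs⟩ := RTree.labelAt_eq_some hc
    by_cases hp : p = []
    · subst hp
      have e : τ (t.replaceAt [] .var) = one := by
        rw [RTree.replaceAt_nil]
        exact hτ.map_one
      simp only [true_and, not_true, false_and, or_false, RTree.varsBefore_nil, e]
    · simp only [hp, false_and, not_false_eq_true, true_and, false_or]
      have hne : t.replaceAt p .var ≠ .var := fun e => hp (RTree.replaceAt_eq_var hs e)
      have hnv := RTree.numVars_replaceAt hs .var
      have hle := RTree.varsBefore_add_le hs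
      change _ = t.numVars + 1 at hnv
      rw [h' t ht p ⟨_, hc⟩ fun s hs' => hne (RTree.factorsAt_iff.1 hs').2.1.symm]
      constructor
      · rintro ⟨r, s, hf, hr⟩
        have hrank : rank r = a + 1 + b := hf.2.2.2.1
        obtain ⟨-, rfl, ha, -⟩ := RTree.factorsAt_iff.1 hf
        exact ⟨ha, (h _ hrank hne Fin.elim0 fun x => x.elim0).1 hr⟩
      · rintro ⟨ha, hd'⟩
        have hrank : (t.replaceAt p .var).numVars = a + 1 + b := by
          rw [← hb, ← hd']
          exact (hτ.map_rank _).symm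
        refine ⟨_, _, RTree.factorsAt_iff.2 ⟨hs, rfl, ha, by omega⟩, ?_⟩
        exact (h _ hrank hne Fin.elim0 fun x => x.elim0).2 hd'
  · refine (Definable.const False).congr fun t ht _ ν hν => ?_
    refine ⟨False.elim, fun h => hd ?_⟩
    obtain ⟨⟨m, c⟩, hc⟩ := hν 0
    obtain ⟨ts, hs⟩ := RTree.labelAt_eq_some hc
    have hnv := RTree.numVars_replaceAt hs .var
    have hle := RTree.varsBefore_add_le hs
    have hrank : rank d = (t.replaceAt (ν 0) .var).numVars := by
      rw [← h.2]
      exact hτ.map_rank _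
    change t.numVars = n at ht
    change _ = t.numVars + 1 at hnv
    omega

/-- The values of the subtrees at the children of a node are definable: for the children that are
variable leaves this is clear, and for the others it follows from `R2`. -/
lemma definable_below (hrel : RelativizesBelow 𝒦) (hτ : IsMorphism τ)
    (hdef : ∀ l d, Definable 𝒦 Γ l 0 (fun t _ => τ t = d)) {i : ℕ}
    (hi : ∃ m, i < m ∧ Nonempty (Γ.Letter m)) (e : T) :
    Definable 𝒦 Γ n 1 (fun t ν => ∃ s, t.subtree (ν 0 ++ [i]) = some s ∧ τ s = e) := by
  have hvar : Definable 𝒦 Γ n 1 (fun t ν => t.subtree (ν 0 ++ [i]) = some .var) := by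
    refine (Definable.exists fun j : Fin n => ⟨.max i j 0, by trivial,
      fun _ _ _ _ _ => Iff.rfl⟩).congr fun t ht _ ν _ => ?_
    constructor
    · rintro ⟨j, h, -⟩
      exact h
    · intro h
      have hle := RTree.varsBefore_add_le h
      exact ⟨⟨t.varsBefore (ν 0 ++ [i]), lt_of_lt_of_eq hle ht⟩, h, rfl⟩
  have hψ : ∀ a b : ℕ, Definable 𝒦 Γ n 1 (fun t ν =>
      t.subtree (ν 0 ++ [i]) ≠ some .var ∧
        ∃ r s, t.FactorsAt (ν 0 ++ [i]) a b r s ∧ rank s = rank e ∧ τ s = e) := by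
    intro a b
    by_cases hn : a + rank e + b = n
    · subst hn
      obtain ⟨φ, hφ, h⟩ := hdef (rank e) e
      obtain ⟨ψ, hψ, h'⟩ := hrel Γ i hi a b (rank e) φ hφ
      have hψ' : Definable 𝒦 Γ (a + rank e + b) 1 (fun t ν => Sat t ψ ν) :=
        ⟨ψ, hψ, fun _ _ _ _ _ => Iff.rfl⟩
      refine (hvar.not.and hψ').congr fun t ht _ ν hν => and_congr_right fun hne => ?_
      obtain ⟨p, rfl⟩ : ∃ p, ν = fun _ => p :=
        ⟨ν 0, funext fun x => by rw [Subsingleton.elim x 0]⟩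
      rw [h' t ht p (hν 0) fun r hr => hne hr.1]
      refine exists_congr fun r => exists_congr fun s => and_congr_right fun hf =>
        and_congr_right fun hs => ?_
      exact h s hs (fun hs' => hne (by rw [← hs']; exact hf.1)) Fin.elim0 fun x => x.elim0
    · refine (Definable.const False).congr fun t ht _ ν _ => ⟨False.elim, ?_⟩
      rintro ⟨-, r, s, hf, hs, -⟩
      have := (RTree.factorsAt_iff.1 hf).2.2.2
      exact hn (by rw [← hs]; exact this.trans ht)
  refine ((hvar.and (Definable.const (one = e))).or
    (Definable.exists fun a : Fin (n + 1) =>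
    Definable.exists fun b : Fin (n + 1) => hψ a b)).congr fun t ht _ ν _ => ?_
  constructor
  · rintro (⟨h, he⟩ | ⟨a, b, -, r, s, hf, -, he⟩)
    · exact ⟨_, h, hτ.map_one.trans he⟩
    · exact ⟨s, hf.1, he⟩
  · rintro ⟨s, hs, he⟩
    by_cases hs' : s = .var
    · subst hs'
      exact .inl ⟨hs, hτ.map_one.symm.trans he⟩
    · have hle := RTree.varsBefore_add_le hs
      change t.numVars = n at ht
      refine .inr ⟨⟨t.varsBefore (ν 0 ++ [i]), by omega⟩,
        ⟨n - t.varsBefore (ν 0 ++ [i]) - s.numVars, by omega⟩, ?_, _, s,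
        RTree.factorsAt_iff.2 ⟨hs, rfl, rfl, ?_⟩, ?_, he⟩
      · rw [hs]
        simpa using hs'
      · dsimp only
        omega
      · rw [← he, hτ.map_rank]

/-- Every property of the context of a node (in a tree with a fixed context) is definable. -/
lemma definable_atNode (hrel : AdmitsRelativization 𝒦) (hT : Preclone.Finitary T)
    (hτ : IsMorphism τ) (hdef : ∀ l d, Definable 𝒦 Γ l 0 (fun t _ => τ t = d)) {m : ℕ}
    (b : Γ.Letter m) (c : SeqContext T) (R : Set (SeqContext T)) :
    Definable 𝒦 Γ n 1
      (fun t ν => t.labelAt (ν 0) = some ⟨m, b⟩ ∧ c.atNode τ t (ν 0) ∈ R) := by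
  have hf₁ := (hT.finite_rank_le (n + 1)).to_subtype
  have hf₂ := (hT.finite_rank_le n).to_subtype
  let ext : (Fin m → {s : T | rank s ≤ n}) → ℕ → T :=
    fun e i => if h : i < m then (e ⟨i, h⟩).1 else one
  refine (Definable.exists fun a : Fin (n + 1) =>
    Definable.exists fun d : {s : T | rank s ≤ n + 1} =>
    Definable.exists fun e : Fin m → {s : T | rank s ≤ n} =>
      ((definable_letter b).and ((definable_above hrel.1 hτ hdef a d.1).and
        (Definable.forall fun i : Fin m =>
          definable_below hrel.2 hτ hdef ⟨m, i.2, ⟨b⟩⟩ (e i).1))).and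
      (Definable.const (c.ofData n a d.1 (ext e) ∈ R))).congr fun t ht _ ν hν => ?_
  -- The data that determine the context of a node, read off from the tree.
  have key : ∀ (e : Fin m → {s : T | rank s ≤ n}), t.labelAt (ν 0) = some ⟨m, b⟩ →
      (∀ i : Fin m, ∃ s, t.subtree (ν 0 ++ [(i : ℕ)]) = some s ∧ τ s = (e i).1) →
      ext e = fun i => τ (t.subtreeD (ν 0 ++ [i])) := by
    intro e hb he
    funext i
    by_cases hi : i < m
    · obtain ⟨s, hs, he⟩ := he ⟨i, hi⟩
      simp only [ext, dif_pos hi, ← he, RTree.subtreeD, hs, Option.getD_some]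
    · obtain ⟨ts, hs⟩ := RTree.labelAt_eq_some hb
      simp only [ext, dif_neg hi, RTree.subtreeD, RTree.subtree_append hs,
        RTree.subtree_node_cons_of_ge b ts hi]
      exact hτ.map_one.symm
  constructor
  · rintro ⟨a, d, e, ⟨hb, ⟨ha, hd⟩, he⟩, hR⟩
    refine ⟨hb, ?_⟩
    rw [key e hb he, ← ha, ← hd, ← ht] at hR
    exact hR
  · rintro ⟨hb, hR⟩
    obtain ⟨ts, hs⟩ := RTree.labelAt_eq_some hb
    have hle := RTree.varsBefore_add_le hs
    have hnv := RTree.numVars_replaceAt hs .var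
    have ht' : t.numVars = n := ht
    change _ = t.numVars + 1 at hnv
    have hkid : ∀ i : Fin m, t.subtree (ν 0 ++ [(i : ℕ)]) = some (ts i) := by
      intro i
      rw [RTree.subtree_append hs, RTree.subtree_node_cons b ts i.2, RTree.subtree_nil,
        RTree.kid_val]
    have hrank : ∀ i, rank (τ (ts i)) ≤ n := by
      intro i
      have := RTree.varsBefore_add_le (hkid i)
      rw [hτ.map_rank]
      change (ts i).numVars ≤ n
      omega
    have he : ∀ i : Fin m, ∃ s, t.subtree (ν 0 ++ [(i : ℕ)]) = some s ∧ τ s = τ (ts i) :=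
      fun i => ⟨_, hkid i, rfl⟩
    refine ⟨⟨t.varsBefore (ν 0), by omega⟩, ⟨τ (t.replaceAt (ν 0) .var), ?_⟩,
      fun i => ⟨τ (ts i), hrank i⟩, ⟨hb, ⟨rfl, rfl⟩, he⟩, ?_⟩
    · change rank (τ _) ≤ n + 1
      rw [hτ.map_rank]
      change (t.replaceAt (ν 0) .var).numVars ≤ n + 1
      omega
    · rw [key (fun i => ⟨τ (ts i), hrank i⟩) hb he]
      unfold SeqContext.atNode at hR
      rwa [ht] at hR

end LForm

/-! ### Definability of the languages recognized by the block product -/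

/-- The ranked alphabet formed by the generators of a pg-pair with finitely many generators. -/
lemma PGPair.exists_alphabet (P : PGPair.{u}) (hP : P.gens.Finite) :
    ∃ (Δ : RankedAlphabet) (f : ∀ n, Δ.Letter n → P.Carrier),
      (∀ n δ, rank (f n δ) = n) ∧ (∀ n, Function.Injective (f n)) ∧
        (∀ n δ, f n δ ∈ P.gens) ∧ ∀ n, ∀ a ∈ P.gens, rank a = n → ∃ δ, f n δ = a := by
  have := hP.to_subtype
  obtain ⟨N, ⟨e⟩⟩ := Finite.exists_equiv_fin P.gens
  refine ⟨⟨fun n => {i : Fin N // rank (e.symm i).1 = n}, ?_⟩, fun n i => (e.symm i.1).1,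
    fun n i => i.2, fun n i j h => Subtype.ext (e.symm.injective (Subtype.ext h)),
    fun n i => (e.symm i.1).2, fun n a ha hn => ⟨⟨e ⟨a, ha⟩, ?_⟩, ?_⟩⟩
  · refine Finite.of_injective (β := Fin N) (fun x => x.2.1) ?_
    rintro ⟨n, i, hi⟩ ⟨m, j, hj⟩ (rfl : i = j)
    obtain rfl : n = m := hi.symm.trans hj
    rfl
  · rw [e.symm_apply_apply]
    exact hn
  · exact congrArg Subtype.val (e.symm_apply_apply _)

/-- If all languages recognized by a pg-pair are definable, then so are the fibers of each morphism
that maps the letters to generators. -/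
lemma PGPair.definable_fiber {𝒦 : LanguageClass} {P : PGPair.{u}}
    (hP : ∀ (Γ : RankedAlphabet) (n : ℕ) (L : TreeLanguage Γ n),
      P.Recognizes L → L ∈ LindClass 𝒦 Γ n) {Γ : RankedAlphabet}
    {φ : RTree Γ.Letter → P.Carrier} (hφ : IsMorphism φ)
    (hφ' : ∀ (n : ℕ) (a : Γ.Letter n), φ (RTree.letter a) ∈ P.gens) (n : ℕ) (x : P.Carrier) :
    Definable 𝒦 Γ n 0 (fun t _ => φ t = x) := by
  have h := hP Γ n {t | φ t.1 = x} ⟨φ, hφ, hφ', {x}, fun _ => Iff.rfl⟩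
  refine (mem_lindClass_iff.1 h).congr fun t ht _ _ _ => ?_
  exact ⟨fun ⟨_, h⟩ => h, fun h => ⟨ht, h⟩⟩

namespace BlockProduct

variable {𝒦 : LanguageClass} {P : PGPair.{u}} {Q : PGPair.{v}} {k : ℕ} {Γ : RankedAlphabet}
  {φ : RTree Γ.Letter → BlockProduct k P.Carrier Q.Carrier}

/-- The fibers of the first component of a morphism into the block product, at a fixed context, are
definable: the first component is the value of a tree over the generators of the first factor,
obtained by a definable relabeling. -/
lemma definable_eval (hrel : AdmitsRelativization 𝒦) (hP : P.gens.Finite)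
    (hQ : Preclone.Finitary Q.Carrier)
    (hPL : ∀ (Γ : RankedAlphabet) (n : ℕ) (L : TreeLanguage Γ n),
      P.Recognizes L → L ∈ LindClass 𝒦 Γ n)
    (hΓ : ∀ m, Nonempty (Γ.Letter m) → ∃ a ∈ P.gens, rank a = m) (hφ : IsMorphism φ)
    (hletter : ∀ (m : ℕ) (a : Γ.Letter m) C, (φ (RTree.letter a)).fst C ∈ P.gens)
    (hdef : ∀ l d, Definable 𝒦 Γ l 0 (fun t _ => (φ t).snd = d)) {n : ℕ}
    (C : Context Q.Carrier k n) (s : P.Carrier) :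
    Definable 𝒦 Γ n 0 (fun t _ => (φ t).eval (SeqContext.ofContext C) = s) := by
  obtain ⟨Δ, f, hf, hinj, hgens, hsurj⟩ := P.exists_alphabet hP
  have hτ := isMorphism_snd hφ
  set c := SeqContext.ofContext C
  have hc : ∀ t, rank t = n → c.Valid k (rank (φ t).snd) := by
    intro t ht
    rw [hτ.map_rank, ht]
    exact ⟨C, SeqContext.represents_ofContext C⟩
  have hΔ : ∀ m, Nonempty (Γ.Letter m) → Nonempty (Δ.Letter m) := by
    intro m h
    obtain ⟨a, ha, hm⟩ := hΓ m h
    obtain ⟨δ, -⟩ := hsurj m a ha hm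
    exact ⟨δ⟩
  -- The new letter is the generator of `P` that labels the node. Only nodes of trees of rank `n`
  -- matter; elsewhere an arbitrary letter is chosen, which exists by `hΔ`.
  have hG : ∀ (t : RTree Γ.Letter) (p : List ℕ) (m : ℕ) (a : Γ.Letter m), ∃ δ : Δ.Letter m,
      rank t = n → t.labelAt p = some ⟨m, a⟩ →
        f m δ = (φ (RTree.letter a)).eval (c.atNode (fun t => (φ t).snd) t p) := by
    intro t p m a
    by_cases h : rank t = n ∧ t.labelAt p = some ⟨m, a⟩
    · have hm : rank (φ (RTree.letter a)).snd = m := by rw [hτ.map_rank, RTree.rank_letter]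
      have hv := (hc t h.1).atNode hτ t h.2
      obtain ⟨D, hD⟩ : (c.atNode (fun t => (φ t).snd) t p).Valid k
          (rank (φ (RTree.letter a)).snd) := by rwa [hm]
      obtain ⟨δ, hδ⟩ := hsurj m _ (hletter m a D) ((rank_fst _ D).trans hm)
      exact ⟨δ, fun _ _ => hδ.trans (eval_eq _ hD).symm⟩
    · obtain ⟨δ⟩ := hΔ m ⟨a⟩
      exact ⟨δ, fun h₁ h₂ => absurd ⟨h₁, h₂⟩ h⟩
  choose G hG using hG
  have hE : Definable 𝒦 Δ n 0 (fun t _ => RTree.lift f hf t = s) :=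
    P.definable_fiber hPL (RTree.isMorphism_lift f hf)
      (fun m δ => by rw [RTree.lift_letter]; exact hgens m δ) n s
  refine (hE.relabel hΔ G fun m δ => ?_).congr fun t ht _ _ _ => ?_
  · refine (Definable.exists fun a : Γ.Letter m => definable_atNode hrel hQ hτ hdef a c
      {c' | f m δ = (φ (RTree.letter a)).eval c'}).congr fun t ht _ ν _ => ?_
    refine exists_congr fun a => and_congr_right fun ha => ?_
    rw [Set.mem_ofPred_eq, ← hG t (ν 0) m a ht ha]
    exact ⟨fun h => (hinj m h).symm, fun h => congrArg (f m) h.symm⟩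
  · rw [lift_relabel hφ f hf t (hc t ht) (G t) fun p m a ha => hG t p m a ht ha]

end BlockProduct

theorem mainTheorem9 (𝒦 : LanguageClass)
    (h𝒦 : ∀ (Δ : RankedAlphabet) (k : ℕ), ∀ K ∈ 𝒦 Δ k, Recognizable K)
    (hrel : AdmitsRelativization 𝒦)
    (P : PGPair.{u}) (Q : PGPair.{v}) (hP : P.Finitary) (hQ : Q.Finitary)
    (hPL : ∀ (Γ : RankedAlphabet) (n : ℕ) (L : TreeLanguage Γ n),
      P.Recognizes L → L ∈ LindClass 𝒦 Γ n)
    (hQL : ∀ (Γ : RankedAlphabet) (n : ℕ) (L : TreeLanguage Γ n),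
      Q.Recognizes L → L ∈ LindClass 𝒦 Γ n)
    (k : ℕ) (Γ : RankedAlphabet) (n : ℕ) (L : TreeLanguage Γ n)
    (hΓ : ∀ m, Nonempty (Γ.Letter m) → ∃ a ∈ P.gens, rank a = m)
    (hL : (PGPair.blockProduct k P Q).Recognizes L) :
    L ∈ LindClass 𝒦 Γ n := by
  obtain ⟨φ₀, hφ₀, hgens, R, hR⟩ := hL
  let φ : RTree Γ.Letter → BlockProduct k P.Carrier Q.Carrier := fun t => (φ₀ t).1
  have hφ : IsMorphism φ :=
    ⟨hφ₀.map_rank, congrArg Subtype.val hφ₀.map_one,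
      fun f g => congrArg Subtype.val (hφ₀.map_comp f g)⟩
  have hτ := BlockProduct.isMorphism_snd hφ
  have hdef : ∀ l d, Definable 𝒦 Γ l 0 (fun t _ => (φ t).snd = d) :=
    Q.definable_fiber hQL hτ fun m a => (hgens m a).1
  have hfin := hQ.1.finite_context k n
  -- An element of rank `n` is determined by its second component and by the values of its first
  -- component at the finitely many `n`-ary contexts.
  let val : BlockProduct k P.Carrier Q.Carrier → Q.Carrier × (Context Q.Carrier k n → P.Carrier) :=
    fun X => (X.snd, fun C => X.eval (SeqContext.ofContext C))
  have hV : ({d : Q.Carrier | rank d = n} ×ˢ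
      (Set.univ.pi fun _ : Context Q.Carrier k n => {s : P.Carrier | rank s = n})).Finite :=
    (hQ.1 n).prod (Set.Finite.pi fun _ => hP.1 n)
  rw [mem_lindClass_iff]
  refine (Definable.of_fibers hV (fun t _ => val (φ t)) ?_ ?_
    {x | ∃ Y ∈ R, val Y.1 = x}).congr fun t ht _ _ _ => ?_
  · intro t ht _ _
    have hn : rank (φ t).snd = n := (hτ.map_rank t).trans ht
    refine ⟨hn, fun C _ => ?_⟩
    subst hn
    change rank ((φ t).eval _) = _
    rw [BlockProduct.eval_eq _ (SeqContext.represents_ofContext C), BlockProduct.rank_fst]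
  · intro x _
    refine ((hdef n x.1).and (Definable.forall fun C =>
      BlockProduct.definable_eval hrel hP.2 hQ.1 hPL hΓ hφ (fun m a => (hgens m a).2) hdef C
        (x.2 C))).congr fun t _ _ _ _ => ?_
    rw [Prod.ext_iff, funext_iff]
  · constructor
    · rintro ⟨Y, hY, h⟩
      refine ⟨ht, (hR ⟨t, ht⟩).2 ?_⟩
      have hn : rank (φ t).snd = n := (hτ.map_rank t).trans ht
      have h₁ : (φ t).snd = Y.1.snd := (congrArg Prod.fst h).symm
      have e : φ₀ t = Y := Subtype.ext (BlockProduct.ext_eval h₁ hn fun C =>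
        (congrFun (congrArg Prod.snd h) C).symm)
      rw [e]
      exact hY
    · rintro ⟨ht', h⟩
      exact ⟨φ₀ t, (hR _).1 h, rfl⟩
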